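/- For $f\in L^2(\mathbb R^d)$ let $\widehat f(\xi)=\int f(x)e^{-2\pi i x\cdot\xi}\,dx$ (extended to $L^2$ by Plancherel). A sequence $(h_n)_{n\in\mathbb N}$ in $L^2(\mathbb R^d)$ is a Riesz basis if it is the image of an orthonormal basis under a bounded invertible operator; its biorthogonal basis is the unique sequence $(\widetilde h_n)_{n}$ with $(h_n,\widetilde h_m)=\delta_{nm}$. The sequence $(h_n)$ has phase-space localization of magnitude $s$ if $$\sup_{n}\Big(\inf_{a\in\mathbb R^d}\int_{\mathbb R^d}|x-a|^{2s}|h_n(x)|^2dx+\inf_{b\in\mathbb R^d}\int_{\mathbb R^d}|\xi-b|^{2s}|\widehat{h_n}(\xi)|^2d\xi\Big)<\infty ,$$ and it has phase-space localization of magnitude $s$ at the points $\lambda_n=(a_n,b_n)\in\mathbb R^{2d}$ if $$\sup_{n}\Big(\int_{\mathbb R^d}|x-a_n|^{2s}|h_n(x)|^2dx+\int_{\mathbb R^d}|\xi-b_n|^{2s}|\widehat{h_n}(\xi)|^2d\xi\Big)<\infty .$$ **Lemma.** Let $(h_n)_{n\in\mathbb N}$ be a Riesz basis for $L^2(\mathbb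 R^d)$ that has phase-space localization of magnitude $s$. (i) If $s>0$, then there are points $\lambda_n\in\mathbb R^{2d}$ at which $(h_n)$ has phase-space localization of magnitude $s$, and for every such choice of points $(\lambda_n)$ there is a constant $C$ with $$|(h_m,h_n)|\le C\,(1+|\lambda_n-\lambda_m|)^{-s}\qquad\text{for all } n,m .$$ (ii) If $s>3d$, then the biorthogonal basis $(\widetilde h_n)$ has phase-space localization of magnitude $t$ for every $t\in(d,\,s-2d)$. -/

import Mathlib

open MeasureTheory FourierTransform
open scoped ENNReal

/-- The Hilbert space `L²(ℝᵈ)` of complex-valued functions. -/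
abbrev L2Rd (d : ℕ) : Type :=
  Lp ℂ 2 (volume : Measure (EuclideanSpace ℝ (Fin d)))

section RieszBases

variable {H : Type*} [NormedAddCommGroup H] [InnerProductSpace ℂ H]

/-- A sequence in a Hilbert space is a Riesz basis if it is the image of an orthonormal basis under
a bounded bijective operator with bounded inverse. -/
def IsRieszBasis (h : ℕ → H) : Prop :=
  ∃ (e : HilbertBasis ℕ ℂ H) (T : H ≃L[ℂ] H), ∀ n, h n = T (e n)

/-- The sequences `h` and `g` are biorthogonal: `(hₙ, gₘ) = δₙₘ`. -/
def IsBiorthogonal (h g : ℕ → H) : Prop :=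
  ∀ n m, inner ℂ (h n) (g m) = if n = m then 1 else 0

/-- A Riesz basis has exactly one biorthogonal sequence, and that sequence is a Riesz basis: the
biorthogonal basis exists and is determined by `IsBiorthogonal`. -/
theorem IsRieszBasis.existsUnique_biorthogonal [CompleteSpace H] {h : ℕ → H}
    (hh : IsRieszBasis h) :
    (∃! g : ℕ → H, IsBiorthogonal h g) ∧ ∀ g : ℕ → H, IsBiorthogonal h g → IsRieszBasis g := by
  obtain ⟨e, T, hT⟩ := hh
  let A : H →L[ℂ] H := ContinuousLinearMap.adjoint (T : H →L[ℂ] H)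
  let B : H →L[ℂ] H := ContinuousLinearMap.adjoint (T.symm : H →L[ℂ] H)
  have hAB : ∀ x, A (B x) = x := fun x => by
    refine ext_inner_left ℂ fun y => ?_
    simp [A, B, ContinuousLinearMap.adjoint_inner_right]
  have hBA : ∀ x, B (A x) = x := fun x => by
    refine ext_inner_left ℂ fun y => ?_
    simp [A, B, ContinuousLinearMap.adjoint_inner_right]
  have key : ∀ g : ℕ → H, IsBiorthogonal h g → ∀ m, g m = B (e m) := by
    intro g hg m
    have h1 : A (g m) = e m := by
      apply e.repr.injective
      ext n
      rw [e.repr_apply_apply, e.repr_apply_apply, orthonormal_iff_ite.mp e.orthonormal n m,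
        ← hg n m, hT n]
      simp [A, ContinuousLinearMap.adjoint_inner_right]
    rw [← h1, hBA]
  refine ⟨⟨fun m => B (e m), ?_, fun g hg => funext (key g hg)⟩, fun g hg => ?_⟩
  · intro n m
    rw [hT n, ← orthonormal_iff_ite.mp e.orthonormal n m]
    simp [B, ContinuousLinearMap.adjoint_inner_right]
  · exact ⟨e, ContinuousLinearEquiv.equivOfInverse B A hAB hBA, fun m => key g hg m⟩

end RieszBases

/-- `∫ |x - a|^{2s} |f(x)|² dx`, with value in `[0, ∞]`. -/
noncomputable def weightedMass {d : ℕ} (s : ℝ) (f : L2Rd d) (a : EuclideanSpace ℝ (Fin d)) :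
    ℝ≥0∞ :=
  ∫⁻ x, ‖x - a‖ₑ ^ (2 * s) * ‖f x‖ₑ ^ 2

/-- Phase-space localization of magnitude `s`:
`supₙ (inf_a ∫ |x - a|^{2s} |fₙ(x)|² dx + inf_b ∫ |ξ - b|^{2s} |f̂ₙ(ξ)|² dξ) < ∞`. -/
def HasPhaseSpaceLocalization {d : ℕ} (s : ℝ) (f : ℕ → L2Rd d) : Prop :=
  ⨆ n, ((⨅ a, weightedMass s (f n) a) + ⨅ b, weightedMass s (𝓕 (f n)) b) < ∞

/-- Phase-space localization of magnitude `s` at the points `λₙ = (aₙ, bₙ)` of `ℝ²ᵈ = ℝᵈ × ℝᵈ`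
(with its Euclidean norm):
`supₙ (∫ |x - aₙ|^{2s} |fₙ(x)|² dx + ∫ |ξ - bₙ|^{2s} |f̂ₙ(ξ)|² dξ) < ∞`. -/
def HasPhaseSpaceLocalizationAt {d : ℕ} (s : ℝ) (f : ℕ → L2Rd d)
    (l : ℕ → WithLp 2 (EuclideanSpace ℝ (Fin d) × EuclideanSpace ℝ (Fin d))) : Prop :=
  ⨆ n, (weightedMass s (f n) (l n).fst + weightedMass s (𝓕 (f n)) (l n).snd) < ∞

/-- The family `h`, indexed by the points `lₙ`, is `s`-localized:
`|(hₘ, hₙ)| ≤ C (1 + |lₙ - lₘ|)^{-s}` for all `n`, `m`. -/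
def IsGramLocalized {H V : Type*} [NormedAddCommGroup H] [InnerProductSpace ℂ H]
    [NormedAddCommGroup V] (s : ℝ) (l : ℕ → V) (h : ℕ → H) : Prop :=
  ∃ C : ℝ, ∀ n m, ‖inner ℂ (h m) (h n)‖ ≤ C * (1 + ‖l n - l m‖) ^ (-s)

/-! For (i), $|a_m-a_n|^s\le 2^s(|x-a_m|^s+|x-a_n|^s)$, so Cauchy–Schwarz turns localization into
decay of $(h_m,h_n)$ in position; Plancherel gives the same decay in frequency
(`HasPhaseSpaceLocalizationAt.isGramLocalized`).

For (ii), write $h_n=Te_n$. The Gram matrix of $h$ is the matrix of $G=T^*T$, that of the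
biorthogonal basis the matrix of $G^{-1}$. Three facts combine. The points $\lambda_n$ have bounded
density: a phase-space cutoff to a ball is Hilbert–Schmidt, and every $h_n$ localized there takes up
a fixed share of its norm (`HasPhaseSpaceLocalizationAt.exists_card_le`). Hence
$\sum_k(1+|\lambda_m-\lambda_k|)^{-\sigma}$ is bounded uniformly in $m$ for $\sigma>2d$. Decay of
order $s>2d$ then passes from $G$ to $G^{-1}=c\sum_k(1-cG)^k$ (Jaffard). The point is to upgrade
$\|1-cG\|<1$ to geometric smallness of the decay constants of the powers (`HasPowDecay.improve`).
Finally, in $\widetilde h_n=\sum_m c_{nm}h_m$ the coefficients decay like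
$(1+|\lambda_n-\lambda_m|)^{-s}$, while the weighted norm of $h_m$ about $\lambda_n$ grows at most
like the power $t$; the sum is bounded because $s-t>2d$. The argument covers all $0\le t<s-2d$;
$s>3d$ only makes $(d,s-2d)$ nonempty. -/

/-! ### Matrices with polynomial off-diagonal decay and their inverses -/

section OffDiagonalDecay

variable {ι H V : Type*} [NormedAddCommGroup H] [InnerProductSpace ℂ H]
  [NormedAddCommGroup V]

/-- The matrix of `A` in the basis `e`, indexed by the points `l`, is bounded by
`M (1 + |lₘ - lₙ|)^{-s}`. -/
def HasOffDiagonalDecay (e : HilbertBasis ι ℂ H) (l : ι → V) (s M : ℝ) (A : H →L[ℂ] H) : Prop :=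
  ∀ m n, ‖inner ℂ (e m) (A (e n))‖ ≤ M * (1 + ‖l m - l n‖) ^ (-s)

/-- The sums `∑ₖ (1 + |lₘ - lₖ|)^{-σ}` are bounded by `S`, uniformly in `m`. -/
def HasSchurBound (l : ι → V) (σ S : ℝ) : Prop :=
  ∀ m, ∀ F : Finset ι, ∑ k ∈ F, (1 + ‖l m - l k‖) ^ (-σ) ≤ S

theorem HasSchurBound.nonneg [Nonempty ι] {l : ι → V} {σ S : ℝ} (h : HasSchurBound l σ S) :
    0 ≤ S := by
  simpa using h (Classical.arbitrary ι) ∅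

theorem one_add_norm_sub_rpow_le (x y z : V) {s : ℝ} (hs : 0 ≤ s) :
    (1 + ‖x - z‖) ^ s ≤ 2 ^ s * ((1 + ‖x - y‖) ^ s + (1 + ‖y - z‖) ^ s) := by
  have h1 : 1 + ‖x - z‖ ≤ 2 * max (1 + ‖x - y‖) (1 + ‖y - z‖) := by
    have := norm_sub_le_norm_sub_add_norm_sub x y z
    have h2 := le_max_left (1 + ‖x - y‖) (1 + ‖y - z‖)
    have h3 := le_max_right (1 + ‖x - y‖) (1 + ‖y - z‖)
    linarith
  have h0 : 0 ≤ max (1 + ‖x - y‖) (1 + ‖y - z‖) := le_max_of_le_left (by positivity)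
  refine (Real.rpow_le_rpow (by positivity) h1 hs).trans ?_
  rw [Real.mul_rpow (by norm_num) h0]
  gcongr
  rcases max_cases (1 + ‖x - y‖) (1 + ‖y - z‖) with ⟨h, -⟩ | ⟨h, -⟩ <;> rw [h]
  · exact le_add_of_nonneg_right (by positivity)
  · exact le_add_of_nonneg_left (by positivity)

namespace HasOffDiagonalDecay

variable {e : HilbertBasis ι ℂ H} {l : ι → V} {s σ S M N a b : ℝ} {A B : H →L[ℂ] H}

theorem mono_const (h : HasOffDiagonalDecay e l s M A) (hMN : M ≤ N) :
    HasOffDiagonalDecay e l s N A := fun m n =>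
  (h m n).trans (by gcongr)

theorem mono_exponent (h : HasOffDiagonalDecay e l s M A) (hM : 0 ≤ M) (hσ : σ ≤ s) :
    HasOffDiagonalDecay e l σ M A := fun m n =>
  (h m n).trans (by
    gcongr
    linarith [norm_nonneg (l m - l n)])

theorem one (e : HilbertBasis ι ℂ H) (l : ι → V) (s : ℝ) :
    HasOffDiagonalDecay e l s 1 (1 : H →L[ℂ] H) := by
  classical
  intro m n
  rw [one_apply_eq_self, orthonormal_iff_ite.mp e.orthonormal m n]
  split_ifs with h
  · simp [h]
  · simp only [norm_zero]
    positivity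

theorem one_sub_smul (h : HasOffDiagonalDecay e l s M A) (c : ℝ) (hc : 0 ≤ c) :
    HasOffDiagonalDecay e l s (1 + c * M) (1 - (c : ℂ) • A) := fun m n => by
  have h1 := one e l s m n
  rw [sub_apply, inner_sub_right, smul_apply,
    inner_smul_right]
  refine (norm_sub_le _ _).trans ?_
  rw [norm_mul, Complex.norm_real, Real.norm_of_nonneg hc, add_mul, mul_assoc]
  exact add_le_add h1 (by gcongr; exact h m n)

/-- Interpolation between the operator norm and off-diagonal decay. -/
theorem interpolate (h : HasOffDiagonalDecay e l s M A) (hM : 0 ≤ M) (hσ : 0 ≤ σ) (hσs : σ ≤ s)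
    {r : ℝ} (hA : ‖A‖ ≤ r) {ρ : ℝ} (hρ : 0 < ρ) :
    HasOffDiagonalDecay e l σ (r * ρ ^ σ + M * ρ ^ (-(s - σ))) A := fun m n => by
  set w := 1 + ‖l m - l n‖ with hw
  have hw0 : 0 < w := by positivity
  have hr : 0 ≤ r := (norm_nonneg _).trans hA
  rw [add_mul]
  -- Near the diagonal the operator norm is used, beyond distance $\rho$ the decay.
  rcases le_total w ρ with hwρ | hwρ
  · refine le_add_of_le_of_nonneg ?_ (by positivity)
    have h1 : ‖inner ℂ (e m) (A (e n))‖ ≤ r := by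
      refine (norm_inner_le_norm _ _).trans ?_
      have := (A.le_opNorm (e n)).trans (mul_le_mul_of_nonneg_right hA (norm_nonneg _))
      rw [e.orthonormal.1 n, mul_one] at this
      rwa [e.orthonormal.1 m, one_mul]
    refine h1.trans ?_
    rw [mul_assoc]
    refine le_mul_of_one_le_right hr ?_
    rw [Real.rpow_neg hw0.le, ← div_eq_mul_inv, one_le_div (by positivity)]
    exact Real.rpow_le_rpow hw0.le hwρ hσ
  · refine le_add_of_nonneg_of_le (by positivity) ((h m n).trans ?_)
    rw [mul_assoc]
    gcongr
    have : -s = -(s - σ) + -σ := by ring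
    rw [this, Real.rpow_add hw0]
    gcongr ?_ * _
    exact Real.rpow_le_rpow_of_nonpos hρ hwρ (by linarith)

/-- After expanding $(e_m,ABe_n)$ through the basis, the weight of the pair $(m,n)$ falls on one
factor, and the other factor only needs the order-$\sigma$ decay that the Schur bound sums. So each
term of the constant contains just one order-$s$ constant, which is what `HasPowDecay.improve`
exploits. -/
theorem mul [CompleteSpace H] (hS : HasSchurBound l σ S) (hs : 0 ≤ s)
    (hM : 0 ≤ M) (hN : 0 ≤ N) (ha : 0 ≤ a) (hb : 0 ≤ b)
    (hA : HasOffDiagonalDecay e l s M A) (hA' : HasOffDiagonalDecay e l σ a A)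
    (hB : HasOffDiagonalDecay e l s N B) (hB' : HasOffDiagonalDecay e l σ b B) :
    HasOffDiagonalDecay e l s (2 ^ s * S * (a * N + M * b)) (A * B) := fun m n => by
  have hsum := e.hasSum_inner_mul_inner (ContinuousLinearMap.adjoint A (e m)) (B (e n))
  simp only [ContinuousLinearMap.adjoint_inner_left] at hsum
  rw [mul_apply_eq_comp]
  refine le_of_tendsto hsum.norm (Filter.Eventually.of_forall fun F => ?_)
  set w := 1 + ‖l m - l n‖ with hw
  have hw0 : 0 < w := by positivity
  rw [Real.rpow_neg hw0.le, ← div_eq_mul_inv, le_div_iff₀ (by positivity)]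
  have key : ∀ k, ‖inner ℂ (e m) (A (e k)) * inner ℂ (e k) (B (e n))‖ * w ^ s ≤
      2 ^ s * (a * N * (1 + ‖l m - l k‖) ^ (-σ) + M * b * (1 + ‖l n - l k‖) ^ (-σ)) := by
    intro k
    have h1 := one_add_norm_sub_rpow_le (l m) (l k) (l n) hs
    have hmk := hA m k
    have hkn := hB k n
    have hmk' := hA' m k
    have hkn' := hB' k n
    rw [norm_sub_rev (l n)]
    set x := ‖inner ℂ (e m) (A (e k))‖
    set y := ‖inner ℂ (e k) (B (e n))‖
    have hx : 0 ≤ x := norm_nonneg _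
    have hy : 0 ≤ y := norm_nonneg _
    have p1 : (0:ℝ) < 1 + ‖l m - l k‖ := by positivity
    have p2 : (0:ℝ) < 1 + ‖l k - l n‖ := by positivity
    rw [Real.rpow_neg p1.le, ← div_eq_mul_inv, le_div_iff₀ (by positivity)] at hmk
    rw [Real.rpow_neg p2.le, ← div_eq_mul_inv, le_div_iff₀ (by positivity)] at hkn
    rw [norm_mul]
    calc x * y * w ^ s ≤ x * y * (2 ^ s * ((1 + ‖l m - l k‖) ^ s + (1 + ‖l k - l n‖) ^ s)) := by
          gcongr
      _ = 2 ^ s * (x * (y * (1 + ‖l k - l n‖) ^ s) + (x * (1 + ‖l m - l k‖) ^ s) * y) := by ring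
      _ ≤ 2 ^ s * ((a * (1 + ‖l m - l k‖) ^ (-σ)) * N + M * (b * (1 + ‖l k - l n‖) ^ (-σ))) := by
          gcongr
      _ = _ := by ring
  calc ‖∑ k ∈ F, inner ℂ (e m) (A (e k)) * inner ℂ (e k) (B (e n))‖ * w ^ s
      ≤ ∑ k ∈ F, ‖inner ℂ (e m) (A (e k)) * inner ℂ (e k) (B (e n))‖ * w ^ s := by
        rw [← Finset.sum_mul]
        gcongr
        exact norm_sum_le _ _
    _ ≤ ∑ k ∈ F, 2 ^ s *
        (a * N * (1 + ‖l m - l k‖) ^ (-σ) + M * b * (1 + ‖l n - l k‖) ^ (-σ)) :=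
        Finset.sum_le_sum fun k _ => key k
    _ = 2 ^ s * (a * N * (∑ k ∈ F, (1 + ‖l m - l k‖) ^ (-σ)) +
        M * b * ∑ k ∈ F, (1 + ‖l n - l k‖) ^ (-σ)) := by
        rw [← Finset.mul_sum, Finset.sum_add_distrib, Finset.mul_sum, Finset.mul_sum]
    _ ≤ 2 ^ s * (a * N * S + M * b * S) := by
        gcongr
        · exact hS m F
        · exact hS n F
    _ = _ := by ring

theorem mul_self [CompleteSpace H] (hS : HasSchurBound l σ S) (hs : 0 ≤ s)
    (hM : 0 ≤ M) (ha : 0 ≤ a)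
    (hA : HasOffDiagonalDecay e l s M A) (hA' : HasOffDiagonalDecay e l σ a A) :
    HasOffDiagonalDecay e l s (2 ^ (s + 1) * S * (a * M)) (A * A) := by
  refine (mul hS hs hM hM ha ha hA hA' hA hA').mono_const (le_of_eq ?_)
  rw [Real.rpow_add_one (by norm_num)]
  ring

theorem mul_of_le [CompleteSpace H] (hS : HasSchurBound l σ S) (hs : 0 ≤ s) (hσs : σ ≤ s)
    (hM : 0 ≤ M) (hN : 0 ≤ N)
    (hA : HasOffDiagonalDecay e l s M A) (hB : HasOffDiagonalDecay e l s N B) :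
    HasOffDiagonalDecay e l s (2 ^ (s + 1) * S * (M * N)) (A * B) := by
  refine (mul hS hs hM hN hM hN hA (hA.mono_exponent hM hσs) hB
    (hB.mono_exponent hN hσs)).mono_const (le_of_eq ?_)
  rw [Real.rpow_add_one (by norm_num)]
  ring

end HasOffDiagonalDecay

/-- The powers of `A` have off-diagonal decay, with constants growing at most like `μ ^ k`. -/
def HasPowDecay (e : HilbertBasis ι ℂ H) (l : ι → V) (s μ : ℝ) (A : H →L[ℂ] H) : Prop :=
  ∃ C, 0 ≤ C ∧ ∀ k : ℕ, HasOffDiagonalDecay e l s (C * μ ^ k) (A ^ k)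

variable [CompleteSpace H] {e : HilbertBasis ι ℂ H} {l : ι → V} {s σ S M : ℝ} {A : H →L[ℂ] H}

/-- Submultiplicativity gives a crude rate, usually above 1, from which the improvement starts. -/
theorem HasOffDiagonalDecay.exists_hasPowDecay [Nonempty ι] (hS : HasSchurBound l σ S)
    (hσ : 0 ≤ σ) (hσs : σ ≤ s)
    (hM : 0 ≤ M) (hA : HasOffDiagonalDecay e l s M A) : ∃ μ, 0 < μ ∧ HasPowDecay e l s μ A := by
  have hS0 := hS.nonneg
  refine ⟨max 1 (2 ^ (s + 1) * S * M), by positivity, 1, zero_le_one, fun k => ?_⟩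
  induction k with
  | zero => simpa using HasOffDiagonalDecay.one e l s
  | succ k ih =>
    rw [pow_succ' A]
    refine (hA.mul_of_le hS (hσ.trans hσs) hσs hM (by positivity) ih).mono_const ?_
    rw [one_mul, one_mul, ← mul_assoc, pow_succ']
    gcongr
    exact le_max_right _ _

/-- In $A^{2k}=A^kA^k$ the order-$s$ constant $C\mu^k$ is needed for one factor only. The
order-$\sigma$ constant of the other, interpolated at threshold $\rho^k$, is at most
$(r\rho^\sigma)^k+C\mu^k\rho^{-k(s-\sigma)}\le(1+C)(q^2\mu)^k$, where $\mu\ge1$ absorbs the first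
term. The product has rate $(q\mu)^{2k}$. -/
theorem HasPowDecay.improve [Nonempty ι] (hS : HasSchurBound l σ S) (hσ : 0 ≤ σ) (hσs : σ ≤ s)
    {r ρ q μ : ℝ} (hA : ‖A‖ ≤ r) (hρ : 0 < ρ) (hq : 0 < q)
    (hq1 : r * ρ ^ σ ≤ q ^ 2) (hq2 : ρ ^ (-(s - σ)) ≤ q ^ 2) (hμ : 1 ≤ μ)
    (h : HasPowDecay e l s μ A) : HasPowDecay e l s (q * μ) A := by
  obtain ⟨C, hC, h⟩ := h
  have hS0 := hS.nonneg
  have hs : 0 ≤ s := hσ.trans hσs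
  have hr : 0 ≤ r := (norm_nonneg _).trans hA
  set K := 2 ^ (s + 1) * S with hK
  have hK0 : 0 ≤ K := by positivity
  have hμ0 : 0 < μ := by linarith
  have heven : ∀ k : ℕ, HasOffDiagonalDecay e l s (K * ((1 + C) * C) * (q * μ) ^ (2 * k))
      (A ^ (2 * k)) := by
    intro k
    have hnorm : ‖A ^ k‖ ≤ r ^ k := by
      rcases Nat.eq_zero_or_pos k with rfl | hk
      · exact (pow_zero A ▸ ContinuousLinearMap.norm_id_le : ‖A ^ 0‖ ≤ 1).trans_eq (pow_zero r).symm
      · exact (norm_pow_le' A hk).trans (pow_le_pow_left₀ (norm_nonneg _) hA k)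
    have h1 := (h k).interpolate (by positivity) hσ hσs hnorm (pow_pos hρ k)
    have h2 : HasOffDiagonalDecay e l σ ((1 + C) * (q ^ 2 * μ) ^ k) (A ^ k) := by
      refine h1.mono_const ?_
      rw [← Real.rpow_natCast ρ k, ← Real.rpow_mul hρ.le, ← Real.rpow_mul hρ.le,
        mul_comm (k : ℝ), mul_comm (k : ℝ), Real.rpow_mul hρ.le, Real.rpow_mul hρ.le,
        Real.rpow_natCast, Real.rpow_natCast, ← mul_pow]
      calc (r * ρ ^ σ) ^ k + C * μ ^ k * (ρ ^ (-(s - σ))) ^ k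
          ≤ (q ^ 2) ^ k + C * μ ^ k * (q ^ 2) ^ k := by gcongr
        _ ≤ (q ^ 2) ^ k * μ ^ k + C * μ ^ k * (q ^ 2) ^ k := by
          gcongr
          exact le_mul_of_one_le_right (by positivity) (one_le_pow₀ hμ)
        _ = _ := by rw [mul_pow]; ring
    have h3 := (h k).mul_self hS hs (by positivity) (by positivity) h2
    rw [← pow_add, ← two_mul] at h3
    refine h3.mono_const (le_of_eq ?_)
    rw [pow_mul, mul_pow, mul_pow, mul_pow]
    rw [pow_right_comm μ 2 k]
    ring
  -- One extra factor $A$ changes only the constant, not the rate.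
  have hodd : ∀ k : ℕ, HasOffDiagonalDecay e l s
      (K * (C * μ) * (K * ((1 + C) * C)) / (q * μ) * (q * μ) ^ (2 * k + 1)) (A ^ (2 * k + 1)) := by
    intro k
    have h1 : HasOffDiagonalDecay e l s (C * μ) A := by simpa using h 1
    have h2 := h1.mul_of_le hS hs hσs (by positivity) (by positivity) (heven k)
    rw [← pow_succ'] at h2
    refine h2.mono_const (le_of_eq ?_)
    rw [pow_succ', ← hK]
    field_simp
  refine ⟨max (K * ((1 + C) * C)) (K * (C * μ) * (K * ((1 + C) * C)) / (q * μ)),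
    le_max_of_le_left (by positivity), fun k => ?_⟩
  rcases Nat.even_or_odd' k with ⟨j, rfl | rfl⟩
  · refine (heven j).mono_const ?_
    gcongr
    exact le_max_left _ _
  · refine (hodd j).mono_const ?_
    gcongr
    exact le_max_right _ _

/-- Spectral radius estimate: if `A` is a strict contraction with off-diagonal decay, the decay
constants of its powers are exponentially small. -/
theorem HasOffDiagonalDecay.exists_hasPowDecay_lt_one [Nonempty ι] (hS : HasSchurBound l σ S)
    (hσ : 0 ≤ σ) (hσs : σ < s)
    (hM : 0 ≤ M) (hA : HasOffDiagonalDecay e l s M A) (hA1 : ‖A‖ < 1) :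
    ∃ μ, 0 < μ ∧ μ < 1 ∧ HasPowDecay e l s μ A := by
  -- Continuity at $\rho=1$ allows $\rho$ slightly above 1, which also makes $\rho^{-(s-\sigma)}<1$.
  obtain ⟨ρ, hρ1, hρ⟩ : ∃ ρ : ℝ, 1 < ρ ∧ ‖A‖ * ρ ^ σ < 1 := by
    have hc : Filter.Tendsto (fun ρ : ℝ => ‖A‖ * ρ ^ σ) (nhdsWithin 1 (Set.Ioi 1))
        (nhds (‖A‖ * 1 ^ σ)) :=
      (((Real.continuousAt_rpow_const 1 σ (Or.inl one_ne_zero)).tendsto.const_mul _).mono_left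
        nhdsWithin_le_nhds)
    rw [Real.one_rpow, mul_one] at hc
    obtain ⟨ρ, h1, h2⟩ := ((hc.eventually_lt_const hA1).and self_mem_nhdsWithin).exists
    exact ⟨ρ, h2, h1⟩
  have hρ0 : 0 < ρ := by linarith
  have hρ2 : ρ ^ (-(s - σ)) < 1 := Real.rpow_lt_one_of_one_lt_of_neg hρ1 (by linarith)
  set Q := max (‖A‖ * ρ ^ σ) (ρ ^ (-(s - σ))) with hQ
  have hQ0 : 0 < Q := lt_max_of_lt_right (by positivity)
  have hQ1 : Q < 1 := max_lt hρ hρ2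
  have hq0 : 0 < √Q := Real.sqrt_pos.mpr hQ0
  have hq1 : √Q < 1 := by rw [Real.sqrt_lt' one_pos]; simpa using hQ1
  have hqq : √Q ^ 2 = Q := Real.sq_sqrt hQ0.le
  -- Each improvement multiplies the rate by $\sqrt Q<1$. The iteration stops once the rate is below
  -- 1, since `HasPowDecay.improve` needs $\mu\ge1$.
  have step : ∀ (j : ℕ) (μ : ℝ), 0 < μ → √Q ^ j * μ < 1 → HasPowDecay e l s μ A →
      ∃ μ, 0 < μ ∧ μ < 1 ∧ HasPowDecay e l s μ A := by
    intro j
    induction j with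
    | zero => exact fun μ h0 h1 h => ⟨μ, h0, by simpa using h1, h⟩
    | succ j ih =>
      intro μ h0 h1 h
      rcases lt_or_ge μ 1 with hμ | hμ
      · exact ⟨μ, h0, hμ, h⟩
      · refine ih (√Q * μ) (by positivity) (by rw [← mul_assoc, ← pow_succ]; exact h1)
          (h.improve hS hσ hσs.le le_rfl hρ0 hq0 ?_ ?_ hμ)
        · rw [hqq]; exact le_max_left _ _
        · rw [hqq]; exact le_max_right _ _
  obtain ⟨μ, hμ, h⟩ := hA.exists_hasPowDecay hS hσ hσs.le hM
  obtain ⟨j, hj⟩ := exists_pow_lt_of_lt_one (inv_pos.mpr hμ) hq1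
  exact step j μ hμ (by rwa [lt_inv_comm₀ (by positivity) hμ, ← one_div, lt_div_iff₀' (by positivity)] at hj) h

/-- Off-diagonal decay passes to the inverse of `G`, if `1 - c G` is a strict contraction. -/
theorem HasOffDiagonalDecay.inverse [Nonempty ι] (hS : HasSchurBound l σ S)
    (hσ : 0 ≤ σ) (hσs : σ < s) (hM : 0 ≤ M)
    {G B : H →L[ℂ] H} (hG : HasOffDiagonalDecay e l s M G) (hBG : B * G = 1) {c : ℝ} (hc : 0 < c)
    (hcG : ‖1 - (c : ℂ) • G‖ < 1) : ∃ C, HasOffDiagonalDecay e l s C B := by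
  obtain ⟨μ, hμ0, hμ1, C, hC, hpow⟩ :=
    (hG.one_sub_smul c hc.le).exists_hasPowDecay_lt_one hS hσ hσs (by positivity) hcG
  set A := 1 - (c : ℂ) • G with hA
  have hBsum : HasSum (fun k => (c : ℂ) • A ^ k) B := by
    have h1 := (summable_geometric_of_norm_lt_one hcG).hasSum.const_smul (c : ℂ)
    have h2 := mul_neg_geom_series A hcG
    have h3 : 1 - A = (c : ℂ) • G := by rw [hA]; abel
    rw [h3, smul_mul_assoc] at h2
    have h4 : (c : ℂ) • ∑' k, A ^ k = B := by
      calc (c : ℂ) • ∑' k, A ^ k = (B * G) * ((c : ℂ) • ∑' k, A ^ k) := by rw [hBG, one_mul]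
        _ = B * ((c : ℂ) • (G * ∑' k, A ^ k)) := by rw [mul_assoc, mul_smul_comm]
        _ = B := by rw [h2, mul_one]
    rwa [h4] at h1
  refine ⟨c * (C * (1 - μ)⁻¹), fun m n => ?_⟩
  have h1 : HasSum (fun k => inner ℂ (e m) (((c : ℂ) • A ^ k) (e n))) (inner ℂ (e m) (B (e n))) :=
    ((innerSL ℂ (e m)).hasSum (hBsum.mapL (ContinuousLinearMap.apply ℂ H (e n))))
  have h2 : HasSum (fun k : ℕ => c * (C * μ ^ k) * (1 + ‖l m - l n‖) ^ (-s))
      (c * (C * (1 - μ)⁻¹) * (1 + ‖l m - l n‖) ^ (-s)) :=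
    (((hasSum_geometric_of_lt_one hμ0.le hμ1).mul_left C).mul_left c).mul_right _
  rw [← h1.tsum_eq]
  refine tsum_of_norm_bounded h2 fun k => ?_
  rw [smul_apply, inner_smul_right, norm_mul, Complex.norm_real,
    Real.norm_of_nonneg hc.le, mul_assoc]
  gcongr
  exact hpow k m n

end OffDiagonalDecay

/-! ### Schur sums over relatively separated points -/

/-- Points that are relatively separated, i.e. with uniformly bounded numbers in unit balls, have
finite Schur sums for every exponent above the dimension. -/
theorem exists_hasSchurBound {ι V : Type*} [NormedAddCommGroup V] [NormedSpace ℝ V]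
    [FiniteDimensional ℝ V] [MeasurableSpace V] [BorelSpace V] {l : ι → V} {N σ : ℝ}
    (hN : ∀ (p : V) (F : Finset ι), (∀ n ∈ F, ‖l n - p‖ ≤ 1) → (F.card : ℝ) ≤ N)
    (hσ : (Module.finrank ℝ V : ℝ) < σ) : ∃ S, HasSchurBound l σ S := by
  classical
  let μ : Measure V := Measure.addHaar
  have hσ0 : 0 ≤ σ := (Nat.cast_nonneg _).trans hσ.le
  set c := μ.real (Metric.closedBall (0 : V) 1) with hc
  have hc0 : 0 < c :=
    ENNReal.toReal_pos (Metric.measure_closedBall_pos μ _ one_pos).ne' measure_closedBall_lt_top.ne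
  have hint : Integrable (fun x : V => (1 + ‖x‖) ^ (-σ)) μ := integrable_one_add_norm hσ
  -- Each summand is compared with an integral over the unit ball about $l_k$, where
  -- $1+|x-l_m|\le2(1+|l_m-l_k|)$; this costs $2^\sigma$. At most $N$ of these balls overlap at any
  -- point.
  refine ⟨(N * (2 ^ σ * ∫ x, (1 + ‖x‖) ^ (-σ) ∂μ)) / c, fun m F => ?_⟩
  have hint' : Integrable (fun x : V => 2 ^ σ * (1 + ‖x - l m‖) ^ (-σ)) μ :=
    (hint.comp_sub_right (l m)).const_mul _
  rw [le_div_iff₀ hc0, Finset.sum_mul]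
  set B : ι → Set V := fun k => Metric.closedBall (l k) 1
  have hB : ∀ k, MeasurableSet (B k) := fun k => measurableSet_closedBall
  calc ∑ k ∈ F, (1 + ‖l m - l k‖) ^ (-σ) * c
      ≤ ∑ k ∈ F, ∫ x, (B k).indicator (fun x => 2 ^ σ * (1 + ‖x - l m‖) ^ (-σ)) x ∂μ := by
        refine Finset.sum_le_sum fun k _ => ?_
        rw [integral_indicator (hB k)]
        have h1 : (1 + ‖l m - l k‖) ^ (-σ) * c = ∫ x in B k, (1 + ‖l m - l k‖) ^ (-σ) ∂μ := by
          rw [setIntegral_const, smul_eq_mul, mul_comm, hc, Measure.real, Measure.real,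
            Measure.addHaar_closedBall_center μ (l k)]
        rw [h1]
        refine setIntegral_mono_on (integrableOn_const measure_closedBall_lt_top.ne)
          hint'.integrableOn (hB k) fun x hx => ?_
        have hx : ‖x - l k‖ ≤ 1 := by simpa [B, dist_eq_norm] using hx
        have h2 : 1 + ‖x - l m‖ ≤ 2 * (1 + ‖l m - l k‖) := by
          have := norm_sub_le_norm_sub_add_norm_sub x (l k) (l m)
          rw [norm_sub_rev (l k)] at this
          linarith [norm_nonneg (l m - l k)]
        have h3 : (2 * (1 + ‖l m - l k‖)) ^ (-σ) ≤ (1 + ‖x - l m‖) ^ (-σ) :=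
          Real.rpow_le_rpow_of_nonpos (by positivity) h2 (by linarith)
        rw [Real.mul_rpow (by norm_num) (by positivity), Real.rpow_neg (by norm_num),
          inv_mul_le_iff₀ (by positivity)] at h3
        exact h3
    _ = ∫ x, ∑ k ∈ F, (B k).indicator (fun x => 2 ^ σ * (1 + ‖x - l m‖) ^ (-σ)) x ∂μ :=
        (integral_finsetSum _ fun k _ => hint'.indicator (hB k)).symm
    _ ≤ ∫ x, N * (2 ^ σ * (1 + ‖x - l m‖) ^ (-σ)) ∂μ := by
        refine integral_mono (integrable_finsetSum _ fun k _ => hint'.indicator (hB k))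
          (hint'.const_mul N) fun x => ?_
        simp only [Set.indicator_apply]
        rw [← Finset.sum_filter, Finset.sum_const, nsmul_eq_mul]
        gcongr
        refine hN x _ fun n hn => ?_
        rw [norm_sub_rev, ← dist_eq_norm]
        exact (Finset.mem_filter.mp hn).2
    _ = N * (2 ^ σ * ∫ x, (1 + ‖x‖) ^ (-σ) ∂μ) := by
        rw [integral_const_mul, integral_const_mul,
          integral_sub_right_eq_self (fun x => (1 + ‖x‖) ^ (-σ)) (l m)]

/-! ### Band-limiting on the Fourier side -/

variable {d : ℕ}

/-- The `L²` inverse Fourier transform of an integrable function is given by the integral. -/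
theorem fourierInv_coeFn_ae_eq (f : L2Rd d) (hf : Integrable f) :
    (𝓕⁻ f : L2Rd d) =ᵐ[volume] 𝓕⁻ (f : EuclideanSpace ℝ (Fin d) → ℂ) := by
  have hcont : Continuous (𝓕⁻ (f : EuclideanSpace ℝ (Fin d) → ℂ)) := by
    have := VectorFourier.fourierIntegral_continuous Real.continuous_fourierChar
      (L := -innerₗ (EuclideanSpace ℝ (Fin d))) (continuous_inner (𝕜 := ℝ) (E := EuclideanSpace ℝ (Fin d))).neg hf
    simpa using! this
  -- Tested against smooth compactly supported functions, the inverse transform moves onto the test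
  -- function: for the $L^2$ transform by duality of tempered distributions, for the integral by
  -- Fubini.
  refine ae_eq_of_integral_contDiff_smul_eq
    ((Lp.memLp (𝓕⁻ f : L2Rd d)).locallyIntegrable (by norm_num))
    hcont.locallyIntegrable fun g hg hgc => ?_
  let φ : SchwartzMap (EuclideanSpace ℝ (Fin d)) ℂ :=
    (hgc.comp_left (g := fun r : ℝ => (r : ℂ)) (by simp)).toSchwartzMap
      (Complex.ofRealCLM.contDiff.comp hg)
  have hφ : ∀ x, φ x = (g x : ℂ) := fun x => rfl
  have h1 := congrArg (fun u => u φ) (Lp.fourierInv_toTemperedDistribution_eq f)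
  simp only [TemperedDistribution.fourierInv_apply, Lp.toTemperedDistribution_apply] at h1
  calc ∫ x, g x • (𝓕⁻ f : L2Rd d) x = ∫ x, φ x • (𝓕⁻ f : L2Rd d) x := by
        simp [hφ]
    _ = ∫ x, (𝓕⁻ φ) x • f x := h1.symm
    _ = ∫ x, φ x • 𝓕⁻ (f : EuclideanSpace ℝ (Fin d) → ℂ) x := by
        rw [SchwartzMap.fourierInv_coe]
        have := VectorFourier.integral_fourierIntegral_smul_eq_flip
          (L := -innerₗ (EuclideanSpace ℝ (Fin d))) Real.continuous_fourierChar
          (continuous_inner (𝕜 := ℝ) (E := EuclideanSpace ℝ (Fin d))).neg (φ.integrable (μ := volume)) hf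
        have hflip : (-innerₗ (EuclideanSpace ℝ (Fin d))).flip =
            -innerₗ (EuclideanSpace ℝ (Fin d)) := by
          ext x y; simp [real_inner_comm]
        rw [hflip] at this
        simpa using! this
    _ = _ := by simp [hφ]

theorem lintegral_enorm_sq (f : L2Rd d) : ∫⁻ x, ‖f x‖ₑ ^ 2 = ‖f‖ₑ ^ 2 := by
  have h := eLpNorm_nnreal_pow_eq_lintegral (f := f) (p := 2) (μ := volume) (by norm_num)
  rw [Lp.enorm_def]
  simpa using h.symm

/-- Restriction of the Fourier transform to a set `Q` of finite measure is, on the other side, an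
operator whose point evaluations are given by vectors `k x` with `‖k x‖² = |Q|`. -/
theorem exists_bandlimiting_kernel {Q : Set (EuclideanSpace ℝ (Fin d))} (hQ : MeasurableSet Q)
    (hQ' : volume Q ≠ ∞) :
    ∃ k : EuclideanSpace ℝ (Fin d) → L2Rd d, (∀ x, ‖k x‖ₑ ^ 2 = volume Q) ∧
      ∀ f : L2Rd d, ∃ u : L2Rd d, (u =ᵐ[volume] fun x => inner ℂ (k x) f) ∧
        ∫⁻ x, ‖u x - f x‖ₑ ^ 2 = ∫⁻ ξ in Qᶜ, ‖(𝓕 f : L2Rd d) ξ‖ₑ ^ 2 := by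
  -- The conjugate compensates for the inner product being conjugate-linear in its first slot:
  -- $(\kappa_x,\widehat f)=\int_Q e^{2\pi i x\cdot\xi}\widehat f(\xi)\,d\xi$.
  let κ (x ξ : EuclideanSpace ℝ (Fin d)) : ℂ := Q.indicator (fun ξ => star ((Real.fourierChar (inner ℝ ξ x) : Circle) : ℂ)) ξ
  have hκ : ∀ x, MemLp (κ x) 2 volume := fun x => by
    refine (memLp_indicator_iff_restrict hQ).2 ?_
    have : IsFiniteMeasure (volume.restrict Q) := ⟨by simpa using hQ'.lt_top⟩
    refine MemLp.of_bound (C := 1) (Continuous.aestronglyMeasurable ?_) ?_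
    · exact (continuous_subtype_val.comp (Real.continuous_fourierChar.comp
        (continuous_id.inner continuous_const))).star
    · exact Filter.Eventually.of_forall fun ξ => by rw [norm_star, Circle.norm_coe]
  refine ⟨fun x => 𝓕⁻ ((hκ x).toLp (κ x) : L2Rd d), fun x => ?_, fun f => ?_⟩
  · have h1 : ‖(𝓕⁻ ((hκ x).toLp (κ x)) : L2Rd d)‖ₑ = ‖((hκ x).toLp (κ x) : L2Rd d)‖ₑ := by
      rw [← ofReal_norm, ← ofReal_norm, ← Lp.norm_fourier_eq, fourier_fourierInv_eq]
    rw [h1, ← lintegral_enorm_sq]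
    have h2 : ∀ᵐ ξ, ‖((hκ x).toLp (κ x) : L2Rd d) ξ‖ₑ ^ 2 = Q.indicator (fun _ => 1) ξ := by
      filter_upwards [(hκ x).coeFn_toLp] with ξ hξ
      rw [hξ]
      by_cases h : ξ ∈ Q
      · have h3 : κ x ξ = star ((Real.fourierChar (inner ℝ ξ x) : Circle) : ℂ) :=
          Set.indicator_of_mem h _
        rw [h3, ← ofReal_norm, Set.indicator_of_mem h, norm_star, Circle.norm_coe]
        simp
      · simp [κ, h]
    rw [lintegral_congr_ae h2, lintegral_indicator hQ]
    simp
  · have hF := Lp.memLp (𝓕 f : L2Rd d)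
    have hv := hF.indicator hQ
    let v : L2Rd d := hv.toLp
    have hvQ : (v : EuclideanSpace ℝ (Fin d) → ℂ) =ᵐ[volume] Q.indicator (𝓕 f : L2Rd d) :=
      hv.coeFn_toLp
    have hvint : Integrable v := by
      have : IsFiniteMeasure (volume.restrict Q) := ⟨by simpa using hQ'.lt_top⟩
      have h1 : Integrable (𝓕 f : L2Rd d) (volume.restrict Q) := (hF.restrict Q).integrable (by norm_num)
      exact ((integrable_indicator_iff hQ).2 h1).congr hvQ.symm
    refine ⟨𝓕⁻ v, ?_, ?_⟩
    · filter_upwards [fourierInv_coeFn_ae_eq v hvint] with x hx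
      rw [hx, Real.fourierInv_eq, ← Lp.inner_fourier_eq, fourier_fourierInv_eq, L2.inner_def]
      refine integral_congr_ae ?_
      filter_upwards [hvQ, (hκ x).coeFn_toLp] with ξ h1 h2
      rw [h1, h2, RCLike.inner_apply]
      by_cases h : ξ ∈ Q <;> simp [κ, h, Circle.smul_def, mul_comm]
    · have h1 : ∫⁻ x, ‖(𝓕⁻ v : L2Rd d) x - f x‖ₑ ^ 2 = ‖(𝓕⁻ v : L2Rd d) - f‖ₑ ^ 2 := by
        rw [← lintegral_enorm_sq]
        refine lintegral_congr_ae ?_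
        filter_upwards [Lp.coeFn_sub (𝓕⁻ v : L2Rd d) f] with x hx
        rw [hx, Pi.sub_apply]
      have h2 : ‖(𝓕⁻ v : L2Rd d) - f‖ₑ = ‖v - (𝓕 f : L2Rd d)‖ₑ := by
        rw [← ofReal_norm, ← ofReal_norm, ← Lp.norm_fourier_eq,
          show 𝓕 ((𝓕⁻ v : L2Rd d) - f) = 𝓕 (𝓕⁻ v : L2Rd d) - 𝓕 f from
            map_sub (Lp.fourierTransformₗᵢ (EuclideanSpace ℝ (Fin d)) ℂ) _ _,
          fourier_fourierInv_eq]
      rw [h1, h2, ← lintegral_enorm_sq, ← lintegral_indicator hQ.compl]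
      refine lintegral_congr_ae ?_
      filter_upwards [Lp.coeFn_sub v (𝓕 f : L2Rd d), hvQ] with x hx hx'
      rw [hx, Pi.sub_apply, hx']
      by_cases h : x ∈ Q <;> simp [h]

/-! ### Riesz bases and the Gram matrix of the biorthogonal basis -/

section RieszBasisEstimates

variable {H : Type*} [NormedAddCommGroup H] [InnerProductSpace ℂ H] {h g : ℕ → H}

theorem IsRieszBasis.exists_norm_ge (hh : IsRieszBasis h) : ∃ c, 0 < c ∧ ∀ n, c ≤ ‖h n‖ := by
  obtain ⟨e, T, hT⟩ := hh
  refine ⟨(‖(T.symm : H →L[ℂ] H)‖ + 1)⁻¹, by positivity, fun n => ?_⟩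
  rw [inv_le_iff_one_le_mul₀' (by positivity)]
  have h1 := (T.symm : H →L[ℂ] H).le_opNorm (h n)
  rw [hT n, ContinuousLinearEquiv.coe_coe, T.symm_apply_apply, e.orthonormal.1 n] at h1
  rw [hT n]
  linarith [norm_nonneg (T (e n))]

theorem IsRieszBasis.exists_norm_le (hh : IsRieszBasis h) : ∃ C, 0 ≤ C ∧ ∀ n, ‖h n‖ ≤ C := by
  obtain ⟨e, T, hT⟩ := hh
  refine ⟨‖(T : H →L[ℂ] H)‖, norm_nonneg _, fun n => ?_⟩
  simpa [hT n, e.orthonormal.1 n] using (T : H →L[ℂ] H).le_opNorm (e n)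

variable [CompleteSpace H]

/-- The Bessel inequality for a Riesz basis. -/
theorem IsRieszBasis.exists_bessel (hh : IsRieszBasis h) :
    ∃ B, 0 ≤ B ∧ ∀ (F : Finset ℕ) (x : H), ∑ n ∈ F, ‖inner ℂ x (h n)‖ ^ 2 ≤ B * ‖x‖ ^ 2 := by
  obtain ⟨e, T, hT⟩ := hh
  let A := ContinuousLinearMap.adjoint (T : H →L[ℂ] H)
  refine ⟨‖A‖ ^ 2, by positivity, fun F x => ?_⟩
  have h1 : ∀ n, ‖inner ℂ x (h n)‖ = ‖inner ℂ (e n) (A x)‖ := fun n => by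
    rw [hT n, norm_inner_symm (e n), ContinuousLinearMap.adjoint_inner_left]
    rfl
  simp only [h1]
  refine (e.orthonormal.sum_inner_products_le (A x)).trans ?_
  rw [← mul_pow]
  gcongr
  exact A.le_opNorm x

/-- With $y=Tx$, expanding the square gives $\|x-cT^*y\|^2=\|x\|^2-2c\|y\|^2+c^2\|T^*y\|^2$. The
choice $c\|T\|^2\le1$ bounds this by $\|x\|^2-c\|y\|^2$, and $y$ is bounded below by $x$. The added
ones keep the denominators positive. -/
theorem norm_one_sub_smul_adjoint_mul_lt_one (T : H ≃L[ℂ] H) :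
    ∃ c : ℝ, 0 < c ∧
      ‖1 - (c : ℂ) • (ContinuousLinearMap.adjoint (T : H →L[ℂ] H) * (T : H →L[ℂ] H))‖ < 1 := by
  set a := ‖(T : H →L[ℂ] H)‖ with ha
  set b := ‖(T.symm : H →L[ℂ] H)‖ with hb
  set c : ℝ := (a ^ 2 + 1)⁻¹ with hc
  have hc0 : 0 < c := by positivity
  set q : ℝ := 1 - c * ((b + 1) ^ 2)⁻¹ with hq
  have hq1 : q < 1 := by
    have : 0 < c * ((b + 1) ^ 2)⁻¹ := by positivity
    linarith
  refine ⟨c, hc0, lt_of_le_of_lt (ContinuousLinearMap.opNorm_le_bound _ (Real.sqrt_nonneg q)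
    fun x => ?_) ((Real.sqrt_lt' one_pos).2 (by simpa using hq1))⟩
  have hq0 : 0 ≤ q := by
    have h1 : c ≤ 1 := inv_le_one_of_one_le₀ (by nlinarith [sq_nonneg a])
    have h2 : ((b + 1) ^ 2)⁻¹ ≤ 1 := inv_le_one_of_one_le₀ (by nlinarith [norm_nonneg (T.symm : H →L[ℂ] H)])
    have := mul_le_one₀ h1 (by positivity) h2
    linarith
  refine (sq_le_sq₀ (norm_nonneg _) (by positivity)).1 ?_
  rw [mul_pow, Real.sq_sqrt hq0]
  set y := T x with hy
  set z := ContinuousLinearMap.adjoint (T : H →L[ℂ] H) y with hz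
  have h1 : (1 - (c : ℂ) • (ContinuousLinearMap.adjoint (T : H →L[ℂ] H) * (T : H →L[ℂ] H))) x =
      x - (c : ℂ) • z := by
    simp [hz, hy]
  have h2 : RCLike.re (inner ℂ x ((c : ℂ) • z)) = c * ‖y‖ ^ 2 := by
    rw [inner_smul_right, hz, ContinuousLinearMap.adjoint_inner_right, ContinuousLinearEquiv.coe_coe,
      ← hy, inner_self_eq_norm_sq_to_K]
    norm_cast
    exact (congrArg Complex.re (Complex.ofReal_mul c (‖y‖ ^ 2)).symm).trans (Complex.ofReal_re _)
  have h3 : ‖z‖ ≤ a * ‖y‖ := by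
    rw [ha, ← ContinuousLinearMap.adjoint.norm_map]
    exact ContinuousLinearMap.le_opNorm _ _
  have h4 : ‖x‖ ≤ (b + 1) * ‖y‖ := by
    have := (T.symm : H →L[ℂ] H).le_opNorm y
    rw [hy, ContinuousLinearEquiv.coe_coe, T.symm_apply_apply] at this
    nlinarith [norm_nonneg y]
  rw [h1, @norm_sub_sq ℂ, h2, norm_smul, Complex.norm_real, Real.norm_of_nonneg hc0.le]
  have h5 : ‖z‖ ^ 2 ≤ a ^ 2 * ‖y‖ ^ 2 := by
    rw [← mul_pow]; gcongr
  have h6 : ((b + 1) ^ 2)⁻¹ * ‖x‖ ^ 2 ≤ ‖y‖ ^ 2 := by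
    rw [inv_mul_le_iff₀ (by positivity), ← mul_pow]; gcongr
  have h7 : c * a ^ 2 ≤ 1 := by
    rw [hc, inv_mul_le_iff₀ (by positivity)]; linarith
  have h8 : c * (c * ‖z‖ ^ 2) ≤ c * ‖y‖ ^ 2 := by
    gcongr
    calc c * ‖z‖ ^ 2 ≤ c * (a ^ 2 * ‖y‖ ^ 2) := by gcongr
      _ = (c * a ^ 2) * ‖y‖ ^ 2 := by ring
      _ ≤ 1 * ‖y‖ ^ 2 := by gcongr
      _ = ‖y‖ ^ 2 := one_mul _
  have h9 := mul_le_mul_of_nonneg_left h6 hc0.le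
  rw [hq]
  nlinarith

/-- Biorthogonality says that $T^*g_m$ has the coordinates of $e_m$. -/
theorem IsBiorthogonal.eq_adjoint_symm {e : HilbertBasis ℕ ℂ H} {T : H ≃L[ℂ] H}
    (hT : ∀ n, h n = T (e n)) (hg : IsBiorthogonal h g) (m : ℕ) :
    g m = ContinuousLinearMap.adjoint (T.symm : H →L[ℂ] H) (e m) := by
  have h1 : ContinuousLinearMap.adjoint (T : H →L[ℂ] H) (g m) = e m := by
    apply e.repr.injective
    ext n
    rw [e.repr_apply_apply, e.repr_apply_apply, orthonormal_iff_ite.mp e.orthonormal n m,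
      ← hg n m, hT n, ContinuousLinearMap.adjoint_inner_right]
    rfl
  rw [← h1]
  refine ext_inner_left ℂ fun y => ?_
  simp [ContinuousLinearMap.adjoint_inner_right]

/-- The expansion of a vector in a Riesz basis, with coefficients given by the biorthogonal
basis. -/
theorem IsRieszBasis.hasSum_inner_smul (hh : IsRieszBasis h) (hg : IsBiorthogonal h g) (x : H) :
    HasSum (fun m => inner ℂ (g m) x • h m) x := by
  obtain ⟨e, T, hT⟩ := hh
  have h1 := (e.hasSum_repr (T.symm x)).mapL (T : H →L[ℂ] H)
  simp only [map_smul, e.repr_apply_apply, ContinuousLinearEquiv.coe_coe,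
    T.apply_symm_apply, ← hT] at h1
  refine h1.congr_fun fun m => ?_
  rw [hg.eq_adjoint_symm hT, ContinuousLinearMap.adjoint_inner_left]
  rfl

/-- Jaffard's theorem: off-diagonal decay of the Gram matrix of a Riesz basis passes to the
Gram matrix of the biorthogonal basis. -/
theorem IsGramLocalized.biorthogonal {V : Type*} [NormedAddCommGroup V] {l : ℕ → V} {s σ S : ℝ}
    (hG : IsGramLocalized s l h) (hh : IsRieszBasis h) (hg : IsBiorthogonal h g)
    (hS : HasSchurBound l σ S) (hσ : 0 ≤ σ) (hσs : σ < s) : IsGramLocalized s l g := by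
  obtain ⟨e, T, hT⟩ := hh
  obtain ⟨c, hc, hcT⟩ := norm_one_sub_smul_adjoint_mul_lt_one T
  obtain ⟨C, hC⟩ := hG
  have hC0 : 0 ≤ C := by simpa using (norm_nonneg _).trans (hC 0 0)
  have hdecay : HasOffDiagonalDecay e l s C
      (ContinuousLinearMap.adjoint (T : H →L[ℂ] H) * (T : H →L[ℂ] H)) := fun m n => by
    rw [mul_apply_eq_comp, ContinuousLinearMap.adjoint_inner_right, norm_sub_rev]
    simpa only [ContinuousLinearEquiv.coe_coe, ← hT] using hC n m
  -- The left factor $T^{-1}(T^{-1})^*$ has the Gram matrix of $g$ as its matrix in the basis `e`.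
  have hinv : ((T.symm : H →L[ℂ] H) * ContinuousLinearMap.adjoint (T.symm : H →L[ℂ] H)) *
      (ContinuousLinearMap.adjoint (T : H →L[ℂ] H) * (T : H →L[ℂ] H)) = 1 := by
    ext x
    simp only [mul_apply_eq_comp, ContinuousLinearEquiv.coe_coe, one_apply_eq_self]
    rw [ContinuousLinearEquiv.symm_apply_eq]
    refine ext_inner_left ℂ fun y => ?_
    simp [ContinuousLinearMap.adjoint_inner_right]
  obtain ⟨C', hC'⟩ := hdecay.inverse hS hσ hσs hC0 hinv hc hcT
  refine ⟨C', fun n m => ?_⟩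
  rw [hg.eq_adjoint_symm hT, hg.eq_adjoint_symm hT, ContinuousLinearMap.adjoint_inner_left,
    norm_sub_rev]
  exact hC' m n

end RieszBasisEstimates

/-! ### Weighted mass: change of centre, pairing, series -/

section WeightedMass

variable {d : ℕ} {s t : ℝ}

theorem ENNReal.rpow_le_of_le_add {x y z : ℝ≥0∞} (h : x ≤ y + z) {p : ℝ} (hp : 0 ≤ p) :
    x ^ p ≤ 2 ^ p * (y ^ p + z ^ p) := by
  have h1 : x ≤ 2 * max y z := h.trans (by
    rw [two_mul]; exact add_le_add (le_max_left _ _) (le_max_right _ _))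
  refine (ENNReal.rpow_le_rpow h1 hp).trans ?_
  rw [ENNReal.mul_rpow_of_nonneg _ _ hp]
  gcongr
  rcases max_cases y z with ⟨h, -⟩ | ⟨h, -⟩ <;> rw [h]
  · exact le_self_add
  · exact le_add_self

theorem enorm_sub_rpow_le {E : Type*} [NormedAddCommGroup E] (x a b : E) {p : ℝ}
    (hp : 0 ≤ p) : ‖x - a‖ₑ ^ p ≤ 2 ^ p * (‖x - b‖ₑ ^ p + ‖b - a‖ₑ ^ p) := by
  refine ENNReal.rpow_le_of_le_add ?_ hp
  simpa using enorm_add_le (x - b) (b - a)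

theorem ENNReal.rpow_le_one_add_rpow (x : ℝ≥0∞) {p q : ℝ} (hp : 0 ≤ p) (hpq : p ≤ q) :
    x ^ p ≤ 1 + x ^ q := by
  rcases le_total x 1 with h | h
  · exact (ENNReal.rpow_le_one h hp).trans le_self_add
  · exact (ENNReal.rpow_le_rpow_of_exponent_le h hpq).trans le_add_self

theorem weightedMass_le_of_le (f : L2Rd d) (a b : EuclideanSpace ℝ (Fin d)) (ht : 0 ≤ t)
    (hts : t ≤ s) :
    weightedMass t f a ≤
      2 ^ (2 * t) * ((1 + ‖b - a‖ₑ ^ (2 * t)) * ‖f‖ₑ ^ 2 + weightedMass s f b) := by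
  have hm : AEMeasurable (fun x => ‖f x‖ₑ ^ 2) volume := (Lp.aestronglyMeasurable f).enorm.pow_const 2
  rw [← lintegral_enorm_sq, ← lintegral_const_mul'' _ hm, weightedMass, weightedMass,
    ← lintegral_add_left' (hm.const_mul _), ← lintegral_const_mul' _ _ (by finiteness)]
  refine lintegral_mono fun x => ?_
  rw [← add_mul, ← mul_assoc]
  gcongr
  refine (enorm_sub_rpow_le x a b (by linarith)).trans ?_
  rw [add_right_comm]
  gcongr
  exact ENNReal.rpow_le_one_add_rpow ‖x - b‖ₑ (by linarith) (by linarith)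

/-- Chebyshev's inequality for the weighted mass. -/
theorem mul_setLIntegral_le_weightedMass (f : L2Rd d) (a : EuclideanSpace ℝ (Fin d)) (hs : 0 ≤ s)
    {r : ℝ≥0∞} {U : Set (EuclideanSpace ℝ (Fin d))} (hU : MeasurableSet U)
    (hr : ∀ x ∈ U, r ≤ ‖x - a‖ₑ) :
    r ^ (2 * s) * ∫⁻ x in U, ‖f x‖ₑ ^ 2 ≤ weightedMass s f a := by
  have hm : AEMeasurable (fun x => ‖f x‖ₑ ^ 2) (volume.restrict U) :=
    ((Lp.aestronglyMeasurable f).enorm.pow_const 2).restrict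
  rw [← lintegral_const_mul'' _ hm]
  refine (setLIntegral_mono_ae' hU (Filter.Eventually.of_forall fun x hx => ?_)).trans
    (setLIntegral_le_lintegral U _)
  gcongr
  exact hr x hx

theorem lintegral_enorm_mul_le_weightedMass (f g : L2Rd d) (a : EuclideanSpace ℝ (Fin d)) :
    ∫⁻ x, ‖x - a‖ₑ ^ s * ‖f x‖ₑ * ‖g x‖ₑ ≤ (weightedMass s f a) ^ (1 / 2 : ℝ) * ‖g‖ₑ := by
  have hf : AEMeasurable (fun x => ‖x - a‖ₑ ^ s * ‖f x‖ₑ) volume :=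
    ((measurable_id.sub_const a).enorm.pow_const s).aemeasurable.mul
      (Lp.aestronglyMeasurable f).enorm
  have hg : AEMeasurable (fun x => ‖g x‖ₑ) volume := (Lp.aestronglyMeasurable g).enorm
  refine (ENNReal.lintegral_mul_le_Lp_mul_Lq volume
    Real.HolderConjugate.two_two hf hg).trans (le_of_eq ?_)
  congr 1
  · congr 1
    refine lintegral_congr fun x => ?_
    rw [ENNReal.mul_rpow_of_nonneg _ _ zero_le_two, ← ENNReal.rpow_mul, ENNReal.rpow_two, mul_comm s]
  · simp only [ENNReal.rpow_two]
    rw [lintegral_enorm_sq, ← ENNReal.rpow_two, ← ENNReal.rpow_mul]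
    simp

/-- The triangle inequality through $x$ puts the weight $|a-b|^s$ on $f$ or on $g$, and
Cauchy–Schwarz finishes each term. -/
theorem enorm_inner_mul_le (f g : L2Rd d) (a b : EuclideanSpace ℝ (Fin d)) (hs : 0 ≤ s) :
    ‖inner ℂ f g‖ₑ * ‖a - b‖ₑ ^ s ≤
      2 ^ s * ((weightedMass s f a) ^ (1 / 2 : ℝ) * ‖g‖ₑ +
        (weightedMass s g b) ^ (1 / 2 : ℝ) * ‖f‖ₑ) := by
  have hf : AEMeasurable (fun x => ‖f x‖ₑ) volume := (Lp.aestronglyMeasurable f).enorm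
  have hg : AEMeasurable (fun x => ‖g x‖ₑ) volume := (Lp.aestronglyMeasurable g).enorm
  have hw : AEMeasurable (fun x => ‖x - a‖ₑ ^ s) volume :=
    ((measurable_id.sub_const a).enorm.pow_const s).aemeasurable
  have h1 : ‖inner ℂ f g‖ₑ ≤ ∫⁻ x, ‖f x‖ₑ * ‖g x‖ₑ := by
    rw [L2.inner_def]
    refine (enorm_integral_le_lintegral_enorm _).trans (lintegral_mono fun x => ?_)
    rw [RCLike.inner_apply, enorm_mul, RCLike.enorm_conj, mul_comm]
  calc ‖inner ℂ f g‖ₑ * ‖a - b‖ₑ ^ s ≤ (∫⁻ x, ‖f x‖ₑ * ‖g x‖ₑ) * ‖a - b‖ₑ ^ s := by gcongr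
    _ = ∫⁻ x, ‖f x‖ₑ * ‖g x‖ₑ * ‖a - b‖ₑ ^ s := (lintegral_mul_const'' _ (hf.mul hg)).symm
    _ ≤ ∫⁻ x, 2 ^ s * (‖x - a‖ₑ ^ s * ‖f x‖ₑ * ‖g x‖ₑ + ‖x - b‖ₑ ^ s * ‖g x‖ₑ * ‖f x‖ₑ) := by
        refine lintegral_mono fun x => ?_
        have h2 : ‖a - b‖ₑ ^ s ≤ 2 ^ s * (‖x - a‖ₑ ^ s + ‖x - b‖ₑ ^ s) := by
          simpa only [enorm_sub_rev a x] using enorm_sub_rpow_le a b x hs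
        calc ‖f x‖ₑ * ‖g x‖ₑ * ‖a - b‖ₑ ^ s
            ≤ ‖f x‖ₑ * ‖g x‖ₑ * (2 ^ s * (‖x - a‖ₑ ^ s + ‖x - b‖ₑ ^ s)) := by gcongr
          _ = _ := by ring
    _ = 2 ^ s * ((∫⁻ x, ‖x - a‖ₑ ^ s * ‖f x‖ₑ * ‖g x‖ₑ) +
          ∫⁻ x, ‖x - b‖ₑ ^ s * ‖g x‖ₑ * ‖f x‖ₑ) := by
        rw [lintegral_const_mul' _ _ (by finiteness)]
        congr 1
        exact lintegral_add_left' ((hw.mul hf).mul hg) _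
    _ ≤ _ := by
        gcongr
        · exact lintegral_enorm_mul_le_weightedMass f g a
        · exact lintegral_enorm_mul_le_weightedMass g f b

theorem weightedMass_rpow_half_eq (f : L2Rd d) (a : EuclideanSpace ℝ (Fin d)) (ht : 0 ≤ t) :
    (weightedMass t f a) ^ (1 / 2 : ℝ) =
      eLpNorm (fun x => ((‖x - a‖ ^ t : ℝ) : ℂ) * f x) 2 volume := by
  have h := eLpNorm_nnreal_pow_eq_lintegral (f := fun x => ((‖x - a‖ ^ t : ℝ) : ℂ) * f x) (p := 2)
    (μ := volume) (by norm_num)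
  have h1 : weightedMass t f a = ∫⁻ x, ‖((‖x - a‖ ^ t : ℝ) : ℂ) * f x‖ₑ ^ (2 : ℝ) := by
    refine lintegral_congr fun x => ?_
    rw [enorm_mul, ENNReal.rpow_two, mul_pow, ← ofReal_norm ((_ : ℝ) : ℂ), Complex.norm_real,
      Real.norm_of_nonneg (by positivity), ← ENNReal.ofReal_rpow_of_nonneg (norm_nonneg _) ht,
      ofReal_norm, ← ENNReal.rpow_two (‖x - a‖ₑ ^ t), ← ENNReal.rpow_mul, mul_comm t]
  rw [h1]
  simp only [NNReal.coe_ofNat, ENNReal.coe_ofNat] at h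
  rw [← h, ← ENNReal.rpow_mul]
  simp

/-- The weighted `L²` norm is countably subadditive along series converging in `L²`. -/
theorem weightedMass_rpow_half_le_tsum {c : ℕ → ℂ} {h : ℕ → L2Rd d} {f : L2Rd d}
    (hf : HasSum (fun m => c m • h m) f) (a : EuclideanSpace ℝ (Fin d)) (ht : 0 ≤ t) :
    (weightedMass t f a) ^ (1 / 2 : ℝ) ≤
      ∑' m, ‖c m‖ₑ * (weightedMass t (h m) a) ^ (1 / 2 : ℝ) := by
  let W : EuclideanSpace ℝ (Fin d) → ℂ := fun x => ((‖x - a‖ ^ t : ℝ) : ℂ)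
  have hW : AEStronglyMeasurable W volume :=
    (Complex.continuous_ofReal.comp ((continuous_id.sub continuous_const).norm.rpow_const
      fun _ => Or.inr ht)).aestronglyMeasurable
  have hWm : ∀ u : L2Rd d, AEStronglyMeasurable (fun x => W x * u x) volume := fun u =>
    hW.mul (Lp.aestronglyMeasurable u)
  -- A subsequence of the partial sums converges almost everywhere, so Fatou and Minkowski apply
  -- although multiplication by $W$ is unbounded.
  obtain ⟨ns, -, hns⟩ := (tendstoInMeasure_of_tendsto_Lp hf.tendsto_sum_nat).exists_seq_tendsto_ae
  rw [weightedMass_rpow_half_eq f a ht]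
  refine (Lp.eLpNorm_lim_le_liminf_eLpNorm (fun i => hWm (∑ m ∈ Finset.range (ns i), c m • h m)) _
    (by filter_upwards [hns] with x hx using hx.const_mul (W x))).trans ?_
  refine (Filter.liminf_le_liminf (Filter.Eventually.of_forall fun i => ?_)).trans
    (Filter.liminf_const _).le
  have hsum : (fun x => W x * (∑ m ∈ Finset.range (ns i), c m • h m : L2Rd d) x) =ᵐ[volume]
      ∑ m ∈ Finset.range (ns i), c m • (fun x => W x * h m x) := by
    have h2 : ∀ᵐ x, ∀ m, (c m • h m : L2Rd d) x = c m * h m x :=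
      ae_all_iff.2 fun m => by
        filter_upwards [Lp.coeFn_smul (c m) (h m)] with x hx using by simpa using hx
    filter_upwards [Lp.coeFn_finsetSum (Finset.range (ns i)) fun m => c m • h m, h2] with x h1 h2
    rw [h1, Finset.sum_apply, Finset.sum_apply, Finset.mul_sum]
    refine Finset.sum_congr rfl fun m _ => ?_
    rw [h2 m, Pi.smul_apply, smul_eq_mul]
    ring
  rw [eLpNorm_congr_ae hsum]
  refine (eLpNorm_sum_le (fun m _ => (hWm (h m)).const_smul (c m)) (by norm_num)).trans ?_
  refine le_trans (Finset.sum_le_sum fun m _ => ?_) (ENNReal.sum_le_tsum (Finset.range (ns i)))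
  rw [eLpNorm_const_smul, weightedMass_rpow_half_eq (h m) a ht]

end WeightedMass

/-! ### Localization points and decay of the Gram matrix -/

variable {d : ℕ} {s t : ℝ} {h g : ℕ → L2Rd d}
  {l : ℕ → WithLp 2 (EuclideanSpace ℝ (Fin d) × EuclideanSpace ℝ (Fin d))}

/-- Near-minimizers within 1 of each infimum suffice; they raise the supremum by at most 2. -/
theorem HasPhaseSpaceLocalization.exists_points (hloc : HasPhaseSpaceLocalization s h) :
    ∃ l : ℕ → WithLp 2 (EuclideanSpace ℝ (Fin d) × EuclideanSpace ℝ (Fin d)),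
      HasPhaseSpaceLocalizationAt s h l := by
  have key : ∀ φ : EuclideanSpace ℝ (Fin d) → ℝ≥0∞, (⨅ a, φ a) ≠ ∞ →
      ∃ a, φ a ≤ (⨅ a, φ a) + 1 := fun φ hφ => by
    obtain ⟨a, ha⟩ := iInf_lt_iff.1 (ENNReal.lt_add_right hφ one_ne_zero)
    exact ⟨a, ha.le⟩
  have hfin : ∀ n, (⨅ a, weightedMass s (h n) a) + (⨅ b, weightedMass s (𝓕 (h n)) b) ≠ ∞ :=
    fun n => ((le_iSup _ n).trans_lt hloc).ne
  choose a ha using fun n => key _ (ENNReal.add_ne_top.1 (hfin n)).1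
  choose b hb using fun n => key _ (ENNReal.add_ne_top.1 (hfin n)).2
  refine ⟨fun n => WithLp.toLp 2 (a n, b n), lt_of_le_of_lt (iSup_le fun n => ?_)
    (ENNReal.add_lt_top.2 ⟨hloc, (by finiteness : (2 : ℝ≥0∞) < ∞)⟩)⟩
  calc weightedMass s (h n) (a n) + weightedMass s (𝓕 (h n)) (b n)
      ≤ ((⨅ a, weightedMass s (h n) a) + 1) + ((⨅ b, weightedMass s (𝓕 (h n)) b) + 1) :=
        add_le_add (ha n) (hb n)
    _ = ((⨅ a, weightedMass s (h n) a) + ⨅ b, weightedMass s (𝓕 (h n)) b) + 2 := by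
        rw [add_add_add_comm, one_add_one_eq_two]
    _ ≤ _ := by
        gcongr
        exact le_iSup (fun n => (⨅ a, weightedMass s (h n) a) + ⨅ b, weightedMass s (𝓕 (h n)) b) n

theorem HasPhaseSpaceLocalizationAt.exists_bound (hl : HasPhaseSpaceLocalizationAt s h l) :
    ∃ M : ℝ≥0∞, M ≠ ∞ ∧ (∀ n, weightedMass s (h n) (l n).fst ≤ M) ∧
      ∀ n, weightedMass s (𝓕 (h n)) (l n).snd ≤ M :=
  ⟨_, hl.ne, fun n => le_self_add.trans
      (le_iSup (fun n => weightedMass s (h n) (l n).fst + weightedMass s (𝓕 (h n)) (l n).snd) n),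
    fun n => le_add_self.trans
      (le_iSup (fun n => weightedMass s (h n) (l n).fst + weightedMass s (𝓕 (h n)) (l n).snd) n)⟩

theorem enorm_fourier (f : L2Rd d) : ‖(𝓕 f : L2Rd d)‖ₑ = ‖f‖ₑ := by
  rw [← ofReal_norm, ← ofReal_norm, Lp.norm_fourier_eq]

theorem HasPhaseSpaceLocalizationAt.isGramLocalized (hs : 0 ≤ s) (hh : IsRieszBasis h)
    (hl : HasPhaseSpaceLocalizationAt s h l) : IsGramLocalized s l h := by
  obtain ⟨M, hM, hM1, hM2⟩ := hl.exists_bound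
  obtain ⟨D, hD, hhD⟩ := hh.exists_norm_le
  have hhD' : ∀ n, ‖h n‖ₑ ≤ ENNReal.ofReal D := fun n => by
    rw [← ofReal_norm]; exact ENNReal.ofReal_le_ofReal (hhD n)
  set K : ℝ≥0∞ := 2 ^ s * (M ^ (1 / 2 : ℝ) * ENNReal.ofReal D + M ^ (1 / 2 : ℝ) * ENNReal.ofReal D)
    with hK
  have hKtop : K ≠ ∞ := by
    have : M ^ (1 / 2 : ℝ) ≠ ∞ := ENNReal.rpow_ne_top_of_nonneg (by norm_num) hM
    finiteness
  have real_bound : ∀ m n (x : EuclideanSpace ℝ (Fin d)),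
      ‖inner ℂ (h m) (h n)‖ₑ * ‖x‖ₑ ^ s ≤ K → ‖inner ℂ (h m) (h n)‖ * ‖x‖ ^ s ≤ K.toReal := by
    intro m n x hx
    have := ENNReal.toReal_mono hKtop hx
    rwa [ENNReal.toReal_mul, ← ENNReal.toReal_rpow, toReal_enorm, toReal_enorm] at this
  have h1 : ∀ m n, ‖inner ℂ (h m) (h n)‖ * ‖(l n).fst - (l m).fst‖ ^ s ≤ K.toReal := by
    intro m n
    refine real_bound m n _ ?_
    rw [enorm_sub_rev]
    refine (enorm_inner_mul_le _ _ _ _ hs).trans ?_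
    rw [hK]
    gcongr
    exacts [hM1 m, hhD' n, hM1 n, hhD' m]
  have h2 : ∀ m n, ‖inner ℂ (h m) (h n)‖ * ‖(l n).snd - (l m).snd‖ ^ s ≤ K.toReal := by
    intro m n
    refine real_bound m n _ ?_
    rw [enorm_sub_rev, ← Lp.inner_fourier_eq]
    refine (enorm_inner_mul_le _ _ _ _ hs).trans ?_
    rw [hK, enorm_fourier, enorm_fourier]
    gcongr
    exacts [hM2 m, hhD' n, hM2 n, hhD' m]
  refine ⟨3 ^ s * (D * D + K.toReal + K.toReal), fun n m => ?_⟩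
  have hw : 0 < 1 + ‖l n - l m‖ := by positivity
  rw [Real.rpow_neg hw.le, ← div_eq_mul_inv, le_div_iff₀ (by positivity)]
  set x := ‖(l n).fst - (l m).fst‖ with hx
  set y := ‖(l n).snd - (l m).snd‖ with hy
  have hx0 : 0 ≤ x := norm_nonneg _
  have hy0 : 0 ≤ y := norm_nonneg _
  have hxy : ‖l n - l m‖ ≤ x + y := by
    have h3 := WithLp.prod_norm_sq_eq_of_L2 (l n - l m)
    rw [WithLp.sub_fst, WithLp.sub_snd, ← hx, ← hy] at h3
    exact abs_le_of_sq_le_sq' (by nlinarith) (by positivity) |>.2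
  set z := max 1 (max x y) with hz
  have hz1 : (1 + ‖l n - l m‖) ^ s ≤ 3 ^ s * (1 + x ^ s + y ^ s) := by
    have h4 : 1 + ‖l n - l m‖ ≤ 3 * z := by
      have := le_max_left 1 (max x y)
      have h5 : x ≤ z := (le_max_left x y).trans (le_max_right _ _)
      have h6 : y ≤ z := (le_max_right x y).trans (le_max_right _ _)
      linarith
    refine (Real.rpow_le_rpow hw.le h4 hs).trans ?_
    rw [Real.mul_rpow (by norm_num) (by positivity)]
    gcongr
    have hxs := Real.rpow_nonneg hx0 s
    have hys := Real.rpow_nonneg hy0 s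
    rcases max_choice 1 (max x y) with h | h
    · rw [hz, h, Real.one_rpow]; linarith
    · rcases max_choice x y with h' | h' <;> rw [hz, h, h'] <;> linarith
  have h0 : ‖inner ℂ (h m) (h n)‖ ≤ D * D :=
    (norm_inner_le_norm _ _).trans (mul_le_mul (hhD m) (hhD n) (norm_nonneg _) hD)
  calc ‖inner ℂ (h m) (h n)‖ * (1 + ‖l n - l m‖) ^ s
      ≤ ‖inner ℂ (h m) (h n)‖ * (3 ^ s * (1 + x ^ s + y ^ s)) := by gcongr
    _ = 3 ^ s * (‖inner ℂ (h m) (h n)‖ + ‖inner ℂ (h m) (h n)‖ * x ^ s +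
          ‖inner ℂ (h m) (h n)‖ * y ^ s) := by ring
    _ ≤ _ := by
        gcongr
        exacts [h1 m n, h2 m n]

/-! ### Relative separation of the localization points -/

theorem le_enorm_sub_of_notMem_closedBall {E : Type*} [NormedAddCommGroup E] {x p a : E} {R : ℝ}
    (hx : x ∉ Metric.closedBall p (R + 1)) (ha : ‖a - p‖ ≤ 1) : ENNReal.ofReal R ≤ ‖x - a‖ₑ := by
  rw [Metric.mem_closedBall, not_le, dist_eq_norm] at hx
  rw [← ofReal_norm]
  refine ENNReal.ofReal_le_ofReal ?_
  have := norm_sub_le_norm_sub_add_norm_sub x a p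
  linarith

theorem lintegral_enorm_sq_le_two_mul (f u : L2Rd d) (P : Set (EuclideanSpace ℝ (Fin d))) :
    ∫⁻ x in P, ‖f x‖ₑ ^ 2 ≤ 2 * (∫⁻ x in P, ‖u x‖ₑ ^ 2) + 2 * ∫⁻ x, ‖u x - f x‖ₑ ^ 2 := by
  have hu : AEMeasurable (fun x => ‖u x‖ₑ ^ 2) (volume.restrict P) :=
    ((Lp.aestronglyMeasurable u).enorm.pow_const 2).restrict
  refine le_trans ?_ (add_le_add_right (mul_le_mul_right (setLIntegral_le_lintegral P _) 2) _)
  rw [← lintegral_const_mul' _ _ (by finiteness), ← lintegral_const_mul' _ _ (by finiteness),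
    ← lintegral_add_left' (hu.const_mul 2)]
  refine lintegral_mono fun x => ?_
  have h1 : ‖f x‖ ^ 2 ≤ 2 * ‖u x‖ ^ 2 + 2 * ‖u x - f x‖ ^ 2 := by
    have := norm_sub_norm_le (f x) (u x)
    rw [norm_sub_rev] at this
    nlinarith [sq_nonneg (‖u x‖ - ‖u x - f x‖), norm_nonneg (f x), norm_nonneg (u x),
      norm_nonneg (u x - f x)]
  have h2 := ENNReal.ofReal_le_ofReal h1
  rw [ENNReal.ofReal_add (by positivity) (by positivity), ENNReal.ofReal_mul (by norm_num),
    ENNReal.ofReal_mul (by norm_num), ENNReal.ofReal_pow (norm_nonneg _),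
    ENNReal.ofReal_pow (norm_nonneg _), ENNReal.ofReal_pow (norm_nonneg _)] at h2
  simpa using h2

/-- The points at which a Riesz basis is localized are relatively separated: a time-frequency
cutoff to a ball has finite Hilbert-Schmidt norm. -/
theorem HasPhaseSpaceLocalizationAt.exists_card_le (hs : 0 < s) (hh : IsRieszBasis h)
    (hl : HasPhaseSpaceLocalizationAt s h l) :
    ∃ N : ℝ, ∀ (p : WithLp 2 (EuclideanSpace ℝ (Fin d) × EuclideanSpace ℝ (Fin d)))
      (F : Finset ℕ), (∀ n ∈ F, ‖l n - p‖ ≤ 1) → (F.card : ℝ) ≤ N := by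
  obtain ⟨M, hM, hM1, hM2⟩ := hl.exists_bound
  obtain ⟨c, hc, hhc⟩ := hh.exists_norm_ge
  obtain ⟨B, hB, hbessel⟩ := hh.exists_bessel
  -- By Chebyshev the tails outside radius $R$, counted once in position and twice in frequency,
  -- total at most $3M/R^{2s}\le c^2/2$.
  obtain ⟨R, hR0, hR⟩ : ∃ R : ℝ, 0 < R ∧ 3 * M ≤
      ENNReal.ofReal R ^ (2 * s) * ENNReal.ofReal (c ^ 2 / 2) := by
    have hpos : 0 < 6 * M.toReal / c ^ 2 + 1 := by positivity
    refine ⟨(6 * M.toReal / c ^ 2 + 1) ^ (2 * s)⁻¹, by positivity, ?_⟩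
    rw [ENNReal.ofReal_rpow_of_pos (by positivity), ← Real.rpow_mul hpos.le,
      inv_mul_cancel₀ (by positivity), Real.rpow_one, ← ENNReal.ofReal_mul hpos.le,
      ← ENNReal.ofReal_toReal hM]
    rw [show (3 : ℝ≥0∞) = ENNReal.ofReal 3 by norm_num, ← ENNReal.ofReal_mul (by norm_num)]
    refine ENNReal.ofReal_le_ofReal ?_
    rw [ENNReal.toReal_ofReal ENNReal.toReal_nonneg]
    field_simp
    nlinarith [sq_nonneg c]
  set v : ℝ := volume.real (Metric.closedBall (0 : EuclideanSpace ℝ (Fin d)) (R + 1)) with hv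
  have hvol : ∀ p : EuclideanSpace ℝ (Fin d), volume (Metric.closedBall p (R + 1)) = ENNReal.ofReal v :=
    fun p => by
      rw [Measure.addHaar_closedBall_center, hv, ofReal_measureReal measure_closedBall_lt_top.ne]
  refine ⟨B * v * v / (c ^ 2 / 4), fun p F hF => ?_⟩
  -- The radius $R+1$ makes these balls contain the $R$-balls about the components of every
  -- $\lambda_n$ within 1 of $p$.
  set P := Metric.closedBall p.fst (R + 1) with hP
  set Q := Metric.closedBall p.snd (R + 1) with hQ
  have hPm : MeasurableSet P := measurableSet_closedBall
  have hQm : MeasurableSet Q := measurableSet_closedBall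
  obtain ⟨k, hk, hu⟩ := exists_bandlimiting_kernel hQm measure_closedBall_lt_top.ne
  choose u hu1 hu2 using fun n => hu (h n)
  -- $c^2\le\|h_n\|^2\le2\int_P|u_n|^2+2\int_{Q^c}|\widehat{h_n}|^2+\int_{P^c}|h_n|^2$, and the
  -- tails take at most $c^2/2$.
  have hlower : ∀ n ∈ F, ENNReal.ofReal (c ^ 2 / 4) ≤ ∫⁻ x in P, ‖u n x‖ₑ ^ 2 := by
    intro n hn
    have hfst : ‖(l n).fst - p.fst‖ ≤ 1 := by
      rw [← WithLp.sub_fst]; exact (WithLp.norm_fst_le _ _).trans (hF n hn)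
    have hsnd : ‖(l n).snd - p.snd‖ ≤ 1 := by
      rw [← WithLp.sub_snd]; exact (WithLp.norm_snd_le _ _).trans (hF n hn)
    have t1 := (mul_setLIntegral_le_weightedMass (h n) (l n).fst hs.le hPm.compl
      fun x hx => le_enorm_sub_of_notMem_closedBall hx hfst).trans (hM1 n)
    have t2 := (mul_setLIntegral_le_weightedMass (𝓕 (h n)) (l n).snd hs.le hQm.compl
      fun x hx => le_enorm_sub_of_notMem_closedBall hx hsnd).trans (hM2 n)
    have hτ : 2 * (∫⁻ x in Qᶜ, ‖(𝓕 (h n) : L2Rd d) x‖ₑ ^ 2) + ∫⁻ x in Pᶜ, ‖h n x‖ₑ ^ 2 ≤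
        ENNReal.ofReal (c ^ 2 / 2) := by
      refine (ENNReal.mul_le_mul_iff_right (a := ENNReal.ofReal R ^ (2 * s)) ?_ ?_).1
        (le_trans ?_ hR)
      · exact (ENNReal.rpow_pos (by simpa using hR0) ENNReal.ofReal_ne_top).ne'
      · exact ENNReal.rpow_ne_top_of_nonneg (by positivity) ENNReal.ofReal_ne_top
      · calc _ = 2 * (ENNReal.ofReal R ^ (2 * s) * ∫⁻ x in Qᶜ, ‖(𝓕 (h n) : L2Rd d) x‖ₑ ^ 2) +
              ENNReal.ofReal R ^ (2 * s) * ∫⁻ x in Pᶜ, ‖h n x‖ₑ ^ 2 := by ring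
          _ ≤ 2 * M + M := by gcongr
          _ = 3 * M := by ring
    have hfull : ENNReal.ofReal (c ^ 2) ≤
        2 * (∫⁻ x in P, ‖u n x‖ₑ ^ 2) + ENNReal.ofReal (c ^ 2 / 2) := by
      calc ENNReal.ofReal (c ^ 2) ≤ ‖h n‖ₑ ^ 2 := by
            rw [← ofReal_norm, ← ENNReal.ofReal_pow (norm_nonneg _)]
            exact ENNReal.ofReal_le_ofReal (pow_le_pow_left₀ hc.le (hhc n) 2)
        _ = (∫⁻ x in P, ‖h n x‖ₑ ^ 2) + ∫⁻ x in Pᶜ, ‖h n x‖ₑ ^ 2 := by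
            rw [lintegral_add_compl _ hPm, lintegral_enorm_sq]
        _ ≤ (2 * (∫⁻ x in P, ‖u n x‖ₑ ^ 2) + 2 * ∫⁻ x in Qᶜ, ‖(𝓕 (h n) : L2Rd d) x‖ₑ ^ 2) +
              ∫⁻ x in Pᶜ, ‖h n x‖ₑ ^ 2 := by
            gcongr
            rw [← hu2 n]
            exact lintegral_enorm_sq_le_two_mul (h n) (u n) P
        _ ≤ _ := by
            rw [add_assoc]
            gcongr
    rcases eq_or_ne (∫⁻ x in P, ‖u n x‖ₑ ^ 2) ∞ with hX | hX
    · rw [hX]; exact le_top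
    · have h3 := ENNReal.toReal_mono (by finiteness) hfull
      rw [ENNReal.toReal_add (by finiteness) (by finiteness), ENNReal.toReal_mul,
        ENNReal.toReal_ofReal (by positivity), ENNReal.toReal_ofReal (by positivity),
        ENNReal.toReal_ofNat] at h3
      rw [ENNReal.ofReal_le_iff_le_toReal hX]
      linarith
  -- At almost every $x$, Bessel applied to the kernel $k_x$ bounds $\sum_n|u_n(x)|^2$ by $B|Q|$;
  -- integrating over $P$ gives a bound free of $F$ and $p$.
  have hupper : ∑ n ∈ F, ∫⁻ x in P, ‖u n x‖ₑ ^ 2 ≤ ENNReal.ofReal (B * v * v) := by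
    rw [← lintegral_finsetSum' _ fun n _ =>
      ((Lp.aestronglyMeasurable (u n)).enorm.pow_const 2).restrict]
    have h4 : ∀ᵐ x ∂(volume.restrict P), ∑ n ∈ F, ‖u n x‖ₑ ^ 2 ≤ ENNReal.ofReal (B * v) := by
      refine ae_restrict_of_ae ?_
      filter_upwards [ae_all_iff.2 hu1] with x hx
      have h5 : ‖k x‖ ^ 2 = v := by
        have := congrArg ENNReal.toReal ((hk x).trans (hvol p.snd))
        rwa [ENNReal.toReal_pow, toReal_enorm, ENNReal.toReal_ofReal (by positivity)] at this
      have h6 := ENNReal.ofReal_le_ofReal (hbessel F (k x))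
      rw [h5, ENNReal.ofReal_sum_of_nonneg fun n _ => by positivity] at h6
      refine le_trans (le_of_eq (Finset.sum_congr rfl fun n _ => ?_)) h6
      rw [hx n, ENNReal.ofReal_pow (norm_nonneg _), ofReal_norm]
    refine (lintegral_mono_ae h4).trans ?_
    rw [setLIntegral_const, hvol, ← ENNReal.ofReal_mul (by positivity)]
  have hcard : (F.card : ℝ≥0∞) * ENNReal.ofReal (c ^ 2 / 4) ≤ ENNReal.ofReal (B * v * v) := by
    rw [← nsmul_eq_mul]
    exact (Finset.card_nsmul_le_sum F _ _ hlower).trans hupper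
  have h7 := ENNReal.toReal_mono (by finiteness) hcard
  rw [ENNReal.toReal_mul, ENNReal.toReal_natCast, ENNReal.toReal_ofReal (by positivity),
    ENNReal.toReal_ofReal (by positivity)] at h7
  rwa [le_div_iff₀ (by positivity)]

theorem HasPhaseSpaceLocalizationAt.exists_hasSchurBound (hs : 0 < s) (hh : IsRieszBasis h)
    (hl : HasPhaseSpaceLocalizationAt s h l) {σ : ℝ} (hσ : 2 * (d : ℝ) < σ) :
    ∃ S, HasSchurBound l σ S := by
  obtain ⟨N, hN⟩ := hl.exists_card_le hs hh
  refine _root_.exists_hasSchurBound hN ?_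
  rw [(WithLp.linearEquiv 2 ℝ (EuclideanSpace ℝ (Fin d) × EuclideanSpace ℝ (Fin d))).finrank_eq]
  simpa [← two_mul] using hσ

/-! ### Localization of the biorthogonal basis -/

/-- Weighted masses of a series with decaying coefficients. -/
theorem exists_weightedMass_le {G f : ℕ → L2Rd d} {a : ℕ → EuclideanSpace ℝ (Fin d)}
    {V : Type*} [NormedAddCommGroup V] {l : ℕ → V} (hal : ∀ m n, ‖a m - a n‖ ≤ ‖l m - l n‖)
    {c : ℕ → ℕ → ℂ} {C D S : ℝ} {M : ℝ≥0∞} (hM : M ≠ ∞) (ht : 0 ≤ t) (hts : t ≤ s)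
    (hsum : ∀ n, HasSum (fun m => c n m • f m) (G n))
    (hc : ∀ n m, ‖c n m‖ ≤ C * (1 + ‖l n - l m‖) ^ (-s)) (hD : ∀ m, ‖f m‖ ≤ D)
    (hf : ∀ m, weightedMass s (f m) (a m) ≤ M) (hS : HasSchurBound l (s - t) S) :
    ∃ K : ℝ≥0∞, K ≠ ∞ ∧ ∀ n, weightedMass t (G n) (a n) ≤ K := by
  have hC : 0 ≤ C := by simpa using (norm_nonneg _).trans (hc 0 0)
  have hD0 : 0 ≤ D := (norm_nonneg _).trans (hD 0)
  set A : ℝ := 2 ^ (2 * t) * (2 * D ^ 2 + M.toReal) with hA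
  have hA0 : 0 ≤ A := by positivity
  -- Recentring from $a_m$ to $a_n$ costs the power $t$ of the distance, so the terms below decay
  -- with exponent $s-t$.
  have hterm : ∀ n m, (weightedMass t (f m) (a n)) ^ (1 / 2 : ℝ) ≤
      ENNReal.ofReal (A ^ (1 / 2 : ℝ) * (1 + ‖l n - l m‖) ^ t) := by
    intro n m
    have h1 : weightedMass t (f m) (a n) ≤ ENNReal.ofReal (A * (1 + ‖l n - l m‖) ^ (2 * t)) := by
      refine (weightedMass_le_of_le (f m) (a n) (a m) ht hts).trans ?_
      set w := 1 + ‖l n - l m‖ with hw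
      have hw1 : 1 ≤ w ^ (2 * t) := Real.one_le_rpow (by linarith [norm_nonneg (l n - l m)]) (by linarith)
      have h2 : ‖a m - a n‖ₑ ^ (2 * t) ≤ ENNReal.ofReal (w ^ (2 * t)) := by
        rw [← ofReal_norm, ENNReal.ofReal_rpow_of_nonneg (norm_nonneg _) (by linarith)]
        refine ENNReal.ofReal_le_ofReal (Real.rpow_le_rpow (norm_nonneg _) ?_ (by linarith))
        rw [norm_sub_rev]
        linarith [hal n m]
      have h3 : ‖f m‖ₑ ^ 2 ≤ ENNReal.ofReal (D ^ 2) := by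
        rw [← ofReal_norm, ← ENNReal.ofReal_pow (norm_nonneg _)]
        exact ENNReal.ofReal_le_ofReal (pow_le_pow_left₀ (norm_nonneg _) (hD m) 2)
      have h4 : (2 : ℝ≥0∞) ^ (2 * t) = ENNReal.ofReal (2 ^ (2 * t)) := by
        rw [← ENNReal.ofReal_rpow_of_pos two_pos, ENNReal.ofReal_ofNat]
      calc 2 ^ (2 * t) * ((1 + ‖a m - a n‖ₑ ^ (2 * t)) * ‖f m‖ₑ ^ 2 + weightedMass s (f m) (a m))
          ≤ ENNReal.ofReal (2 ^ (2 * t)) * ((ENNReal.ofReal 1 + ENNReal.ofReal (w ^ (2 * t))) *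
              ENNReal.ofReal (D ^ 2) + ENNReal.ofReal M.toReal) := by
            rw [h4, ENNReal.ofReal_one, ENNReal.ofReal_toReal hM]
            gcongr
            exact hf m
        _ = ENNReal.ofReal (2 ^ (2 * t) * ((1 + w ^ (2 * t)) * D ^ 2 + M.toReal)) := by
            rw [← ENNReal.ofReal_add (by positivity) (by positivity),
              ← ENNReal.ofReal_mul (by positivity), ← ENNReal.ofReal_add (by positivity)
              ENNReal.toReal_nonneg, ← ENNReal.ofReal_mul (by positivity)]
        _ ≤ ENNReal.ofReal (A * w ^ (2 * t)) := by
            refine ENNReal.ofReal_le_ofReal ?_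
            rw [hA, mul_assoc]
            gcongr
            have h5 : M.toReal ≤ M.toReal * w ^ (2 * t) :=
              le_mul_of_one_le_right ENNReal.toReal_nonneg hw1
            nlinarith [sq_nonneg D]
    refine (ENNReal.rpow_le_rpow h1 (by norm_num)).trans (le_of_eq ?_)
    rw [ENNReal.ofReal_rpow_of_nonneg (by positivity) (by norm_num),
      Real.mul_rpow hA0 (by positivity), ← Real.rpow_mul (by positivity)]
    congr 3
    ring
  refine ⟨(ENNReal.ofReal (C * A ^ (1 / 2 : ℝ) * S)) ^ (2 : ℝ), by finiteness, fun n => ?_⟩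
  rw [← ENNReal.rpow_inv_le_iff two_pos, ← one_div]
  refine (weightedMass_rpow_half_le_tsum (hsum n) (a n) ht).trans ?_
  rw [ENNReal.tsum_eq_iSup_sum]
  refine iSup_le fun F => ?_
  calc ∑ m ∈ F, ‖c n m‖ₑ * (weightedMass t (f m) (a n)) ^ (1 / 2 : ℝ)
      ≤ ∑ m ∈ F, ENNReal.ofReal (C * A ^ (1 / 2 : ℝ) * (1 + ‖l n - l m‖) ^ (-(s - t))) := by
        refine Finset.sum_le_sum fun m _ => ?_
        have h6 : ‖c n m‖ₑ ≤ ENNReal.ofReal (C * (1 + ‖l n - l m‖) ^ (-s)) := by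
          rw [← ofReal_norm]; exact ENNReal.ofReal_le_ofReal (hc n m)
        refine (mul_le_mul' h6 (hterm n m)).trans (le_of_eq ?_)
        rw [← ENNReal.ofReal_mul (by positivity)]
        congr 1
        rw [show -(s - t) = -s + t by ring, Real.rpow_add (by positivity)]
        ring
    _ = ENNReal.ofReal (C * A ^ (1 / 2 : ℝ) * ∑ m ∈ F, (1 + ‖l n - l m‖) ^ (-(s - t))) := by
        rw [← ENNReal.ofReal_sum_of_nonneg fun m _ => by positivity, Finset.mul_sum]
    _ ≤ _ := ENNReal.ofReal_le_ofReal (by gcongr; exact hS n F)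

/-- Phase-space localization passes to the biorthogonal basis, with a loss in magnitude. -/
theorem HasPhaseSpaceLocalizationAt.biorthogonal (hs : 0 < s) (hh : IsRieszBasis h)
    (hl : HasPhaseSpaceLocalizationAt s h l) (hg : IsBiorthogonal h g) (ht : 0 ≤ t)
    (hts : t < s - 2 * (d : ℝ)) : HasPhaseSpaceLocalizationAt t g l := by
  obtain ⟨M, hM, hM1, hM2⟩ := hl.exists_bound
  obtain ⟨D, hD, hhD⟩ := hh.exists_norm_le
  have hd : (0 : ℝ) ≤ d := Nat.cast_nonneg d
  -- The exponent $s-t>2d$ sums the series; the midpoint of $2d$ and $s$ gives Jaffard's theorem an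
  -- exponent strictly below $s$.
  obtain ⟨S, hS⟩ := hl.exists_hasSchurBound hs hh (σ := s - t) (by linarith)
  obtain ⟨S', hS'⟩ := hl.exists_hasSchurBound hs hh (σ := (2 * d + s) / 2) (by linarith)
  obtain ⟨C, hC⟩ := (hl.isGramLocalized hs.le hh).biorthogonal hh hg hS' (by linarith)
    (by linarith)
  have hsum := fun n => hh.hasSum_inner_smul hg (g n)
  obtain ⟨K₁, hK₁, h1⟩ := exists_weightedMass_le (a := fun n => (l n).fst)
    (fun m n => by rw [← WithLp.sub_fst]; exact WithLp.norm_fst_le _ _)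
    hM ht (by linarith) hsum hC hhD hM1 hS
  -- The Fourier transform is continuous and linear, so the frequency side has the same
  -- coefficients.
  have hsum' : ∀ n, HasSum (fun m => inner ℂ (g m) (g n) • (𝓕 (h m) : L2Rd d)) (𝓕 (g n)) :=
    fun n => by
      have := (hsum n).mapL
        ((Lp.fourierTransformₗᵢ (EuclideanSpace ℝ (Fin d)) ℂ).toContinuousLinearEquiv :
          L2Rd d →L[ℂ] L2Rd d)
      simp only [map_smul] at this
      exact this
  obtain ⟨K₂, hK₂, h2⟩ := exists_weightedMass_le (a := fun n => (l n).snd)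
    (fun m n => by rw [← WithLp.sub_snd]; exact WithLp.norm_snd_le _ _)
    hM ht (by linarith) hsum' hC (fun m => by rw [Lp.norm_fourier_eq]; exact hhD m) hM2 hS
  exact lt_of_le_of_lt (iSup_le fun n => add_le_add (h1 n) (h2 n))
    (ENNReal.add_lt_top.2 ⟨hK₁.lt_top, hK₂.lt_top⟩)

theorem HasPhaseSpaceLocalizationAt.hasPhaseSpaceLocalization
    (hl : HasPhaseSpaceLocalizationAt s h l) : HasPhaseSpaceLocalization s h :=
  lt_of_le_of_lt (iSup_mono fun _ => add_le_add (iInf_le _ _) (iInf_le _ _)) hl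

theorem mainTheorem6 (d : ℕ) (s : ℝ) (h : ℕ → L2Rd d) (hh : IsRieszBasis h)
    (hloc : HasPhaseSpaceLocalization s h) :
    (0 < s →
      (∃ l : ℕ → WithLp 2 (EuclideanSpace ℝ (Fin d) × EuclideanSpace ℝ (Fin d)),
        HasPhaseSpaceLocalizationAt s h l) ∧
      ∀ l : ℕ → WithLp 2 (EuclideanSpace ℝ (Fin d) × EuclideanSpace ℝ (Fin d)),
        HasPhaseSpaceLocalizationAt s h l → IsGramLocalized s l h) ∧
    (3 * (d : ℝ) < s →
      ∀ g : ℕ → L2Rd d, IsBiorthogonal h g →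
        ∀ t : ℝ, (d : ℝ) < t → t < s - 2 * (d : ℝ) → HasPhaseSpaceLocalization t g) := by
  refine ⟨fun hs => ⟨hloc.exists_points, fun l hl => hl.isGramLocalized hs.le hh⟩,
    fun hs g hg t ht hts => ?_⟩
  have hd : (0 : ℝ) ≤ d := Nat.cast_nonneg d
  obtain ⟨l, hl⟩ := hloc.exists_points
  exact (hl.biorthogonal (by linarith) hh hg (by linarith) hts).hasPhaseSpaceLocalization
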